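/- Let $n\in\{2,3\}$ and let $\Omega\subset\mathbb R^n$ be a bounded domain (non-empty, open, connected) with Lipschitz continuous boundary $S$. Let $\Gamma_1,\dots,\Gamma_k$ (control electrodes) and $\Gamma_{10},\dots,\Gamma_{k0}$ (null electrodes) be open subsets of $S$, not all empty, such that the $\Gamma_i$ are pairwise disjoint and $\Gamma_i\cap\Gamma_{j0}=\emptyset$ for all $i,j$. Values on parts of $S$ are understood in the sense of traces of functions of $H^1(\Omega)$, almost everywhere for the surface measure. Let $\epsilon\in L_\infty(\Omega)$ satisfy $e_1\le\epsilon\le e_2$ a.e. in $\Omega$ with positive constants $e_1,e_2$. Let $T>0$ and, for $t\in[0,T]$ and $i=1,\dots,k$, let $$U_i(t)\in H^{1/2}_{00}(\Gamma_i)=\{\psi \mid \psi=v|_{\Gamma_i},\ v\in H^1(\Omega),\ v|_{S\setminus\overline{\Gamma_i}}=0\}.$$ Put $\tilde V=\{v\in H^1(\Omega)\mid v=0 \text{ on } \bigcup_{i=1}^k(\Gamma_i\cup\Gamma_{i0})\}$ and $$a(v,h)=\int_\Omega \epsilon\,\nabla v\cdot\nabla h\,dx .$$ A generalized solution, at time $t$,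 of the mixed problem $$\operatorname{div}(\epsilon\nabla\theta)=0 \text{ in }\Omega,\quad \theta=U_i(t)\text{ on }\Gamma_i,\quad \theta=0\text{ on }\Gamma_{i0}\ (i=1,\dots,k),\quad \nu\cdot\epsilon\nabla\theta=0\text{ on } S\setminus\overline{\textstyle\bigcup_{i}(\Gamma_i\cup\Gamma_{i0})}$$ is a function $\theta\in H^1(\Omega)$ with $\theta|_{\Gamma_i}=U_i(t)$ and $\theta|_{\Gamma_{i0}}=0$ for all $i$, such that $a(\theta,h)=0$ for all $h\in\tilde V$. Then for every $t\in[0,T]$ there exist functions $\check\theta\in H^1(\Omega)$ with $\check\theta|_{\Gamma_i}=U_i(t)$ and $\check\theta|_{\Gamma_{i0}}=0$ for $i=1,\dots,k$, and there exists a unique generalized solution $\theta$ of the mixed problem. Moreover, for every such $\check\theta$ the problem: find $u\in\tilde V$ with $$a(u,h)=-a(\check\theta,h)\qquad\text{for all } h\in\tilde V$$ has a unique solution $u$, and $\theta=\check\theta+u$. -/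

import Mathlib

open MeasureTheory Filter Topology Set
open scoped ENNReal NNReal ContDiff

noncomputable section

namespace Electrostatics

/-- Euclidean space `ℝⁿ`. -/
abbrev E (n : ℕ) : Type := EuclideanSpace ℝ (Fin n)

variable {n : ℕ}

/-- A bounded domain (non-empty connected open set) with Lipschitz continuous boundary: near each
boundary point, in suitable orthogonal coordinates `(x', xₙ)`, the domain is the set of the points
lying above the graph of a Lipschitz function of `x'`. -/
structure IsBoundedLipschitzDomain (Ω : Set (E n)) : Prop where
  isOpen : IsOpen Ω
  isConnected : IsConnected Ω
  isBounded : Bornology.IsBounded Ω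
  locally_graph : ∀ x₀ ∈ frontier Ω,
    ∃ (Φ : E n ≃ₗᵢ[ℝ] WithLp 2 (E (n - 1) × ℝ)) (γ : E (n - 1) → ℝ) (K : ℝ≥0) (r : ℝ),
      LipschitzWith K γ ∧ 0 < r ∧
        ∀ x ∈ Metric.ball x₀ r, x ∈ Ω ↔ γ (Φ x).fst < (Φ x).snd

/-- `Γ` is an open subset of the boundary `S = frontier Ω` (in the relative topology of `S`). -/
def IsOpenInBoundary (Ω Γ : Set (E n)) : Prop :=
  ∃ O : Set (E n), IsOpen O ∧ Γ = O ∩ frontier Ω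

/-- The `(n-1)`-dimensional surface measure on the boundary `S = frontier Ω`. -/
def surfaceMeasure (Ω : Set (E n)) : Measure (E n) :=
  (μHE[n - 1] : Measure (E n)).restrict (frontier Ω)

/-- `G` is the weak gradient of `u` in `Ω`. -/
def IsWeakGradient (Ω : Set (E n)) (u : E n → ℝ) (G : E n → E n) : Prop :=
  ∀ φ : E n → ℝ, ContDiff ℝ ∞ φ → HasCompactSupport φ → tsupport φ ⊆ Ω → ∀ i : Fin n,
    ∫ x in Ω, u x * fderiv ℝ φ x (EuclideanSpace.single i 1) = - ∫ x in Ω, G x i * φ x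

lemma integrable_mul_test {Ω : Set (E n)} {f g : E n → ℝ}
    (hf : MemLp f 2 (volume.restrict Ω)) (hg : Continuous g) (hs : HasCompactSupport g) :
    Integrable (fun x => f x * g x) (volume.restrict Ω) :=
  MemLp.integrable_mul (p := 2) (q := 2) hf (hg.memLp_of_hasCompactSupport hs)

lemma memLp_coord {Ω : Set (E n)} (G : Lp (E n) 2 (volume.restrict Ω)) (i : Fin n) :
    MemLp (fun x => G x i) 2 (volume.restrict Ω) :=
  (Lp.memLp G).continuousLinearMap_comp (EuclideanSpace.proj i : E n →L[ℝ] ℝ)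

lemma test_deriv {φ : E n → ℝ} (h1 : ContDiff ℝ ∞ φ) (h2 : HasCompactSupport φ) (w : E n) :
    Continuous (fun x => fderiv ℝ φ x w) ∧ HasCompactSupport (fun x => fderiv ℝ φ x w) :=
  ⟨(h1.continuous_fderiv (by simp)).clm_apply continuous_const, h2.fderiv_apply ℝ w⟩

/-- The Sobolev space `H¹(Ω)`: the pairs `(u, ∇u)` of a function `u ∈ L²(Ω)` and its weak gradient
`∇u ∈ L²(Ω)ⁿ`, with the norm `(‖u‖² + ‖∇u‖²)^{1/2}`. The second component is determined by the
first one. -/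
def H1 (Ω : Set (E n)) :
    Submodule ℝ (WithLp 2 (Lp ℝ 2 (volume.restrict Ω) × Lp (E n) 2 (volume.restrict Ω))) where
  carrier := {p | IsWeakGradient Ω p.fst p.snd}
  zero_mem' := by
    intro φ _ _ _ i
    have e1 : ∫ x in Ω, ((0 : Lp ℝ 2 (volume.restrict Ω)) : E n → ℝ) x *
        fderiv ℝ φ x (EuclideanSpace.single i 1) = 0 := by
      refine integral_eq_zero_of_ae ?_
      filter_upwards [Lp.coeFn_zero ℝ 2 (volume.restrict Ω)] with x hx
      rw [hx]
      simp
    have e2 : ∫ x in Ω, ((0 : Lp (E n) 2 (volume.restrict Ω)) : E n → E n) x i * φ x = 0 := by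
      refine integral_eq_zero_of_ae ?_
      filter_upwards [Lp.coeFn_zero (E n) 2 (volume.restrict Ω)] with x hx
      rw [hx]
      simp
    simp only [WithLp.zero_fst, WithLp.zero_snd]
    rw [e1, e2, neg_zero]
  add_mem' := by
    intro p q hp hq φ h1 h2 h3 i
    have hd := test_deriv h1 h2 (EuclideanSpace.single i 1)
    have e1 : ∫ x in Ω, (p.fst + q.fst : Lp ℝ 2 (volume.restrict Ω)) x *
        fderiv ℝ φ x (EuclideanSpace.single i 1) =
        ∫ x in Ω, (p.fst x * fderiv ℝ φ x (EuclideanSpace.single i 1) +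
          q.fst x * fderiv ℝ φ x (EuclideanSpace.single i 1)) := by
      refine integral_congr_ae ?_
      filter_upwards [Lp.coeFn_add p.fst q.fst] with x hx
      rw [hx, Pi.add_apply, add_mul]
    have e2 : ∫ x in Ω, (p.snd + q.snd : Lp (E n) 2 (volume.restrict Ω)) x i * φ x =
        ∫ x in Ω, (p.snd x i * φ x + q.snd x i * φ x) := by
      refine integral_congr_ae ?_
      filter_upwards [Lp.coeFn_add p.snd q.snd] with x hx
      rw [hx, Pi.add_apply, PiLp.add_apply, add_mul]
    simp only [WithLp.add_fst, WithLp.add_snd]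
    rw [e1, e2, integral_add (integrable_mul_test (Lp.memLp _) hd.1 hd.2)
        (integrable_mul_test (Lp.memLp _) hd.1 hd.2),
      integral_add (integrable_mul_test (memLp_coord _ i) h1.continuous h2)
        (integrable_mul_test (memLp_coord _ i) h1.continuous h2),
      hp φ h1 h2 h3 i, hq φ h1 h2 h3 i, neg_add]
  smul_mem' := by
    intro c p hp φ h1 h2 h3 i
    have e1 : ∫ x in Ω, (c • p.fst : Lp ℝ 2 (volume.restrict Ω)) x *
        fderiv ℝ φ x (EuclideanSpace.single i 1) =
        ∫ x in Ω, c * (p.fst x * fderiv ℝ φ x (EuclideanSpace.single i 1)) := by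
      refine integral_congr_ae ?_
      filter_upwards [Lp.coeFn_smul c p.fst] with x hx
      rw [hx, Pi.smul_apply, smul_eq_mul, mul_assoc]
    have e2 : ∫ x in Ω, (c • p.snd : Lp (E n) 2 (volume.restrict Ω)) x i * φ x =
        ∫ x in Ω, c * (p.snd x i * φ x) := by
      refine integral_congr_ae ?_
      filter_upwards [Lp.coeFn_smul c p.snd] with x hx
      rw [hx, Pi.smul_apply, PiLp.smul_apply, smul_eq_mul, mul_assoc]
    simp only [WithLp.smul_fst, WithLp.smul_snd]
    rw [e1, e2, integral_const_mul, integral_const_mul, hp φ h1 h2 h3 i, mul_neg]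

/-- The function underlying an element of `H¹(Ω)`. -/
def func {Ω : Set (E n)} (v : H1 Ω) : Lp ℝ 2 (volume.restrict Ω) :=
  (v : WithLp 2 (Lp ℝ 2 (volume.restrict Ω) × Lp (E n) 2 (volume.restrict Ω))).fst

/-- The weak gradient of an element of `H¹(Ω)`. -/
def grad {Ω : Set (E n)} (v : H1 Ω) : Lp (E n) 2 (volume.restrict Ω) :=
  (v : WithLp 2 (Lp ℝ 2 (volume.restrict Ω) × Lp (E n) 2 (volume.restrict Ω))).snd

/-- An element of `H¹(Ω)` is determined by its underlying function. -/
lemma H1_ext {Ω : Set (E n)} (hΩ : IsOpen Ω) {v w : H1 Ω} (h : func v = func w) : v = w := by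
  have hv : IsWeakGradient Ω (func v) (grad v) := v.2
  have hw : IsWeakGradient Ω (func w) (grad w) := w.2
  have hc : ∀ i : Fin n, ∀ᵐ x, x ∈ Ω → grad v x i - grad w x i = 0 := by
    intro i
    have hi : MemLp (fun x => grad v x i - grad w x i) 2 (volume.restrict Ω) :=
      (memLp_coord _ i).sub (memLp_coord _ i)
    refine hΩ.ae_eq_zero_of_integral_contDiff_smul_eq_zero
      (locallyIntegrableOn_of_locallyIntegrable_restrict (hi.locallyIntegrable (by norm_num))) ?_
    intro φ h1 h2 h3
    have key : ∫ x in Ω, φ x • (grad v x i - grad w x i) = 0 := by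
      have e : ∀ x, φ x • (grad v x i - grad w x i) = grad v x i * φ x - grad w x i * φ x := by
        intro x; simp only [smul_eq_mul]; ring
      simp only [e]
      rw [integral_sub (integrable_mul_test (memLp_coord _ i) h1.continuous h2)
        (integrable_mul_test (memLp_coord _ i) h1.continuous h2)]
      have a := hv φ h1 h2 h3 i
      have b := hw φ h1 h2 h3 i
      rw [h] at a
      linarith
    rwa [setIntegral_eq_integral_of_forall_compl_eq_zero] at key
    intro x hx
    rw [image_eq_zero_of_notMem_tsupport (fun hx' => hx (h3 hx')), zero_smul]
  have hg : grad v = grad w := by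
    refine Lp.ext ?_
    rw [Filter.EventuallyEq, ae_restrict_iff' hΩ.measurableSet]
    filter_upwards [ae_all_iff.2 hc] with x hx hxΩ
    ext i
    exact sub_eq_zero.1 (hx i hxΩ)
  apply Subtype.ext
  apply WithLp.ofLp_injective
  exact Prod.ext h hg

/-- `g ∈ L²(S)` is the trace of `v ∈ H¹(Ω)` on the boundary `S`. The trace operator is the
continuous extension of `φ ↦ φ|_S` from smooth functions to `H¹(Ω)`; this is its graph: some
smooth functions `φₘ` on `ℝⁿ` converge to `v` in `H¹(Ω)` while `φₘ|_S` converge to `g` in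
`L²(S)`. -/
def HasTrace {Ω : Set (E n)} (v : H1 Ω) (g : Lp ℝ 2 (surfaceMeasure Ω)) : Prop :=
  ∃ φ : ℕ → E n → ℝ,
    (∀ m, ContDiff ℝ ∞ (φ m) ∧ HasCompactSupport (φ m)) ∧
    Tendsto (fun m => eLpNorm (fun x => φ m x - func v x) 2 (volume.restrict Ω)) atTop (𝓝 0) ∧
    Tendsto (fun m => eLpNorm (fun x => gradient (φ m) x - grad v x) 2 (volume.restrict Ω))
      atTop (𝓝 0) ∧
    Tendsto (fun m => eLpNorm (fun x => φ m x - g x) 2 (surfaceMeasure Ω)) atTop (𝓝 0)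

/-- The space `H₀₀^{1/2}(Γ)` of the restrictions to `Γ` of the traces of those `v ∈ H¹(Ω)` whose
trace vanishes on `S \ closure Γ`. -/
def H00half (Ω Γ : Set (E n)) : Set (Lp ℝ 2 ((surfaceMeasure Ω).restrict Γ)) :=
  {ψ | ∃ (v : H1 Ω) (g : Lp ℝ 2 (surfaceMeasure Ω)), HasTrace v g ∧
    (g =ᵐ[(surfaceMeasure Ω).restrict Γ] ψ) ∧
    (g =ᵐ[(surfaceMeasure Ω).restrict (frontier Ω \ closure Γ)] 0)}

/-- The Dirichlet conditions on the electrodes for a function of `H¹(Ω)`: it equals `Uᵢ` on the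
control electrode `Γᵢ` and `0` on the null electrode `Γᵢ₀`, for all `i`. -/
def DirichletData {Ω : Set (E n)} {k : ℕ} (Γ Γ₀ : Fin k → Set (E n))
    (U : ∀ i, Lp ℝ 2 ((surfaceMeasure Ω).restrict (Γ i))) (v : H1 Ω) : Prop :=
  ∃ g : Lp ℝ 2 (surfaceMeasure Ω), HasTrace v g ∧
    (∀ i, g =ᵐ[(surfaceMeasure Ω).restrict (Γ i)] U i) ∧
    (∀ i, g =ᵐ[(surfaceMeasure Ω).restrict (Γ₀ i)] 0)

/-- The space `Ṽ` of the functions of `H¹(Ω)` vanishing on all electrodes. -/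
def Vtilde (Ω : Set (E n)) {k : ℕ} (Γ Γ₀ : Fin k → Set (E n)) : Set (H1 Ω) :=
  {v | ∃ g : Lp ℝ 2 (surfaceMeasure Ω), HasTrace v g ∧
    (g =ᵐ[(surfaceMeasure Ω).restrict (⋃ i, (Γ i ∪ Γ₀ i))] 0)}

/-- The bilinear form `a(v, h) = ∫_Ω ε ∇v · ∇h dx`. -/
def form {Ω : Set (E n)} (ε : E n → ℝ) (v h : H1 Ω) : ℝ :=
  ∫ x in Ω, ε x * inner ℝ (grad v x) (grad h x)

/-- `u ∈ Ṽ` and `a(u, h) = -a(θ', h)` for all `h ∈ Ṽ`. -/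
def SolvesVariational {Ω : Set (E n)} {k : ℕ} (Γ Γ₀ : Fin k → Set (E n)) (ε : E n → ℝ)
    (θ' u : H1 Ω) : Prop :=
  u ∈ Vtilde Ω Γ Γ₀ ∧ ∀ h ∈ Vtilde Ω Γ Γ₀, form ε u h = - form ε θ' h

/-- `θ ∈ H¹(Ω)` is a generalized solution of the mixed problem `div (ε ∇θ) = 0` in `Ω`, `θ = Uᵢ`
on `Γᵢ`, `θ = 0` on `Γᵢ₀`, `ν · ε ∇θ = 0` on the rest of the boundary. By Green's formula the
equation and the Neumann condition together are expressed by the integral identity. -/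
def IsGeneralizedSolution {Ω : Set (E n)} {k : ℕ} (Γ Γ₀ : Fin k → Set (E n)) (ε : E n → ℝ)
    (U : ∀ i, Lp ℝ 2 ((surfaceMeasure Ω).restrict (Γ i))) (θ : H1 Ω) : Prop :=
  DirichletData Γ Γ₀ U θ ∧ ∀ h ∈ Vtilde Ω Γ Γ₀, form ε θ h = 0

end Electrostatics

end

open MeasureTheory Filter Topology Set
open scoped ENNReal NNReal ContDiff

noncomputable section

namespace Electrostatics

variable {n : ℕ}

/-! Writing `θ = θ' + u`, with `θ'` any extension of the boundary data, turns the mixed problem into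
the variational problem on `Ṽ`, to which Lax–Milgram applies once `Ṽ` is closed in `H¹(Ω)` and the
form is coercive there. Closedness comes from the trace inequality, coercivity from the Friedrichs
inequality for functions vanishing on a boundary set of positive surface measure.

Both inequalities are instances of one relation between measures, `PoincareRel`: the mean square
oscillation of a `C¹` function between `μ` and `ν` is bounded by its Dirichlet energy. The relation
is symmetric, and for finite measures it is transitive through a nonzero one. Concentric or
overlapping balls in `Ω` are related, so connectedness relates all of them (`poincareRel_ball`).
Near the boundary, volume and surface measure are slid vertically into `Ω` along the local graph
coordinates (`poincareRel_inter_ball`, `poincareRel_surface`). Compactness makes this global. No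
compact embedding is used.

Traces are handled as a closed graph: `HasTrace` is membership in the closure of the data of test
functions (`hasTrace_iff_mem_closure`), so inequalities proved for smooth functions pass to `H¹(Ω)`.
An extension of the data is the sum of the functions given by `H00half`, since each has zero trace
on every other electrode. Uniqueness holds because two candidates differ by an element of `Ṽ`, on
which coercivity applies. -/

lemma exists_coe_eq {x : ℝ≥0∞} (hx : x ≠ ⊤) : ∃ c : ℝ≥0, (c : ℝ≥0∞) = x :=
  ⟨x.toNNReal, ENNReal.coe_toNNReal hx⟩

/-! ### Increments of functions along segments -/

lemma lintegral_sq_le {α : Type*} [MeasurableSpace α] {μ : Measure α} {g : α → ℝ≥0∞}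
    (hg : AEMeasurable g μ) : (∫⁻ x, g x ∂μ) ^ 2 ≤ μ univ * ∫⁻ x, g x ^ 2 ∂μ := by
  have h := ENNReal.lintegral_mul_le_Lp_mul_Lq μ Real.HolderConjugate.two_two hg
    (aemeasurable_const (b := (1 : ℝ≥0∞)))
  simp only [Pi.mul_apply, mul_one, ENNReal.one_rpow, lintegral_const, one_mul] at h
  calc (∫⁻ x, g x ∂μ) ^ 2
      ≤ ((∫⁻ x, g x ^ (2 : ℝ) ∂μ) ^ (1 / 2 : ℝ) * μ univ ^ (1 / 2 : ℝ)) ^ 2 := by gcongr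
    _ = μ univ * ∫⁻ x, g x ^ 2 ∂μ := by
      rw [mul_pow, ← ENNReal.rpow_natCast, ← ENNReal.rpow_natCast, ← ENNReal.rpow_mul,
        ← ENNReal.rpow_mul]
      norm_num
      rw [mul_comm]

lemma lintegral_le_of_le_smul {α : Type*} [MeasurableSpace α] {μ ν : Measure α} {c : ℝ≥0}
    (h : μ ≤ c • ν) (f : α → ℝ≥0∞) : ∫⁻ x, f x ∂μ ≤ c * ∫⁻ x, f x ∂ν := by
  have h1 : ∫⁻ x, f x ∂μ ≤ ∫⁻ x, f x ∂(c • ν) := lintegral_mono' h (le_refl f)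
  rwa [lintegral_smul_measure, ENNReal.smul_def, smul_eq_mul] at h1

lemma enorm_sub_sq_le_lintegral_deriv {f : ℝ → ℝ} (hf : ContDiff ℝ 1 f) {s : ℝ} (hs : 0 ≤ s) :
    ‖f s - f 0‖ₑ ^ 2 ≤ ENNReal.ofReal s * ∫⁻ t in Ioc 0 s, ‖deriv f t‖ₑ ^ 2 := by
  have hc : Continuous (deriv f) := hf.continuous_deriv (by simp)
  have h1 : f s - f 0 = ∫ t in Ioc 0 s, deriv f t := by
    rw [← intervalIntegral.integral_of_le hs, intervalIntegral.integral_deriv_eq_sub]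
    · intro x _
      exact (hf.differentiable (by simp)).differentiableAt
    · exact hc.intervalIntegrable _ _
  rw [h1]
  calc _ ≤ (∫⁻ t in Ioc 0 s, ‖deriv f t‖ₑ) ^ 2 := by
        gcongr
        exact enorm_integral_le_lintegral_enorm _
    _ ≤ _ := by
        refine (lintegral_sq_le hc.enorm.measurable.aemeasurable).trans ?_
        simp

/-- Fundamental theorem of calculus and Cauchy–Schwarz on a segment. Direction and length are kept
apart: translations use `s = 1` with an arbitrary vector, boundary layers use a variable height
along a fixed unit vector. -/
lemma enorm_sub_sq_le_lintegral_fderiv {φ : E n → ℝ} (hφ : ContDiff ℝ 1 φ) (x e : E n) {s : ℝ}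
    (hs : 0 ≤ s) :
    ‖φ (x + s • e) - φ x‖ₑ ^ 2 ≤
      ENNReal.ofReal s * ‖e‖ₑ ^ 2 * ∫⁻ t in Ioc 0 s, ‖fderiv ℝ φ (x + t • e)‖ₑ ^ 2 := by
  have hline : ∀ t : ℝ, HasDerivAt (fun t : ℝ => x + t • e) e t := fun t => by
    simpa using ((hasDerivAt_id t).smul_const e).const_add x
  have hd : ∀ t : ℝ, deriv (fun t : ℝ => φ (x + t • e)) t = fderiv ℝ φ (x + t • e) e := fun t =>
    ((hφ.differentiable (by simp) _).hasFDerivAt.comp_hasDerivAt t (hline t)).deriv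
  have hf : ContDiff ℝ 1 (fun t : ℝ => φ (x + t • e)) := by fun_prop
  have h := enorm_sub_sq_le_lintegral_deriv hf hs
  simp only [zero_smul, add_zero] at h
  refine h.trans ?_
  rw [mul_assoc]
  gcongr
  rw [← lintegral_const_mul' _ _ (by simp)]
  refine lintegral_mono fun t => ?_
  rw [hd, ← mul_pow, mul_comm]
  gcongr
  exact ContinuousLinearMap.le_opENorm _ _

/-! ### Comparing measures through mean square oscillation -/

/-- The Dirichlet energy `∫_Ω |∇φ|²`. -/
def energy (Ω : Set (E n)) (φ : E n → ℝ) : ℝ≥0∞ :=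
  ∫⁻ x in Ω, ‖fderiv ℝ φ x‖ₑ ^ 2

/-- The measures `μ` and `ν` are related if the mean square oscillation between them of every
`C¹` function is controlled by its energy in `Ω`. -/
def PoincareRel (Ω : Set (E n)) (μ ν : Measure (E n)) : Prop :=
  ∃ C : ℝ≥0, ∀ φ : E n → ℝ, ContDiff ℝ 1 φ →
    ∫⁻ x, ∫⁻ y, ‖φ x - φ y‖ₑ ^ 2 ∂ν ∂μ ≤ C * energy Ω φ

lemma enorm_add_sq_le (a b : ℝ) : ‖a + b‖ₑ ^ 2 ≤ 2 * ‖a‖ₑ ^ 2 + 2 * ‖b‖ₑ ^ 2 := by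
  simp only [← ofReal_norm]
  rw [← ENNReal.ofReal_pow (norm_nonneg _), ← ENNReal.ofReal_pow (norm_nonneg _),
    ← ENNReal.ofReal_pow (norm_nonneg _),
    show (2 : ℝ≥0∞) = ENNReal.ofReal 2 by simp, ← ENNReal.ofReal_mul (by norm_num),
    ← ENNReal.ofReal_mul (by norm_num), ← ENNReal.ofReal_add (by positivity) (by positivity)]
  apply ENNReal.ofReal_le_ofReal
  simp only [Real.norm_eq_abs, sq_abs]
  nlinarith [sq_nonneg (a - b)]

lemma enorm_sub_sq_le (a b c : ℝ) :
    ‖a - c‖ₑ ^ 2 ≤ 2 * ‖a - b‖ₑ ^ 2 + 2 * ‖b - c‖ₑ ^ 2 := by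
  simpa using enorm_add_sq_le (a - b) (b - c)

lemma enorm_sq_le (a b : ℝ) : ‖a‖ₑ ^ 2 ≤ 2 * ‖a - b‖ₑ ^ 2 + 2 * ‖b‖ₑ ^ 2 := by
  simpa using enorm_add_sq_le (a - b) b

lemma measurable_enorm_sub_sq {α : Type*} [MeasurableSpace α] {φ : E n → ℝ}
    (hφ : ContDiff ℝ 1 φ) {p q : α → E n} (hp : Measurable p) (hq : Measurable q) :
    Measurable fun a => ‖φ (p a) - φ (q a)‖ₑ ^ 2 := by
  have hc : Measurable φ := hφ.continuous.measurable
  exact ((hc.comp hp).sub (hc.comp hq)).enorm.pow_const 2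

lemma measurable_lintegral_enorm_sub_sq {φ : E n → ℝ} (hφ : ContDiff ℝ 1 φ)
    (κ : Measure (E n)) [SFinite κ] : Measurable fun x => ∫⁻ z, ‖φ x - φ z‖ₑ ^ 2 ∂κ :=
  Measurable.lintegral_prod_right' (f := fun a : E n × E n => ‖φ a.1 - φ a.2‖ₑ ^ 2)
    (measurable_enorm_sub_sq hφ measurable_fst measurable_snd)

lemma measurable_energy_density {φ : E n → ℝ} (hφ : ContDiff ℝ 1 φ) :
    Measurable (fun x => ‖fderiv ℝ φ x‖ₑ ^ 2) :=
  (hφ.continuous_fderiv (by simp)).enorm.measurable.pow_const 2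

namespace PoincareRel

variable {Ω : Set (E n)} {μ ν κ : Measure (E n)}

lemma symm [SFinite μ] [SFinite ν] (h : PoincareRel Ω μ ν) : PoincareRel Ω ν μ := by
  obtain ⟨C, hC⟩ := h
  refine ⟨C, ?_⟩
  intro φ hφ
  rw [lintegral_lintegral_swap
    (measurable_enorm_sub_sq hφ measurable_fst measurable_snd).aemeasurable]
  simpa only [enorm_sub_rev] using hC φ hφ

lemma mono_left {c : ℝ≥0} (h : PoincareRel Ω ν κ) (hμ : μ ≤ c • ν) : PoincareRel Ω μ κ := by
  obtain ⟨C, hC⟩ := h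
  refine ⟨c * C, fun φ hφ => (lintegral_le_of_le_smul hμ _).trans ?_⟩
  rw [ENNReal.coe_mul, mul_assoc]
  gcongr
  exact hC φ hφ

lemma mono_restrict {s t : Set (E n)} (hst : s ⊆ t) (h : PoincareRel Ω (μ.restrict t) κ) :
    PoincareRel Ω (μ.restrict s) κ :=
  h.mono_left (c := 1) (by rw [one_smul]; exact Measure.restrict_mono hst le_rfl)

lemma union {s t : Set (E n)} (hs : PoincareRel Ω (μ.restrict s) κ)
    (ht : PoincareRel Ω (μ.restrict t) κ) : PoincareRel Ω (μ.restrict (s ∪ t)) κ := by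
  obtain ⟨C, hC⟩ := hs
  obtain ⟨D, hD⟩ := ht
  refine ⟨C + D, fun φ hφ => (lintegral_union_le _ _ _).trans ?_⟩
  rw [ENNReal.coe_add, add_mul]
  exact add_le_add (hC φ hφ) (hD φ hφ)

lemma restrict_empty : PoincareRel Ω (μ.restrict ∅) κ := ⟨0, fun φ _ => by simp⟩

/-- The inequality `|φ x - φ z|² ≤ 2|φ x - φ y|² + 2|φ y - φ z|²` is integrated over the
intermediate point `y` as well. The left side gains the factor `ν univ`, which can be divided out
because `ν` is finite and nonzero. -/
lemma trans [IsFiniteMeasure μ] [IsFiniteMeasure ν] [IsFiniteMeasure κ]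
    (h₁ : PoincareRel Ω μ ν) (h₂ : PoincareRel Ω ν κ) (hν : ν ≠ 0) : PoincareRel Ω μ κ := by
  obtain ⟨C, hC⟩ := h₁
  obtain ⟨D, hD⟩ := h₂
  have hν0 : ν univ ≠ 0 := by simpa using hν
  have hνt : ν univ ≠ ⊤ := measure_ne_top _ _
  obtain ⟨c, hc⟩ : ∃ c : ℝ≥0, (c : ℝ≥0∞) = (ν univ)⁻¹ * (2 * κ univ * C + 2 * μ univ * D) := by
    refine exists_coe_eq (ENNReal.mul_ne_top (ENNReal.inv_ne_top.2 hν0) ?_)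
    finiteness
  refine ⟨c, ?_⟩
  intro φ hφ
  have hmx : ∀ x : E n, Measurable fun z => ‖φ x - φ z‖ₑ ^ 2 := fun x =>
    measurable_enorm_sub_sq hφ measurable_const measurable_id
  have key : ν univ * ∫⁻ x, ∫⁻ z, ‖φ x - φ z‖ₑ ^ 2 ∂κ ∂μ ≤
      (2 * κ univ * C + 2 * μ univ * D) * energy Ω φ := by
    calc ν univ * ∫⁻ x, ∫⁻ z, ‖φ x - φ z‖ₑ ^ 2 ∂κ ∂μ
        = ∫⁻ x, ∫⁻ _y, ∫⁻ z, ‖φ x - φ z‖ₑ ^ 2 ∂κ ∂ν ∂μ := by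
          rw [← lintegral_const_mul _ (measurable_lintegral_enorm_sub_sq hφ _)]
          simp [mul_comm]
      _ ≤ ∫⁻ x, ∫⁻ y, ∫⁻ z, (2 * ‖φ x - φ y‖ₑ ^ 2 + 2 * ‖φ y - φ z‖ₑ ^ 2) ∂κ ∂ν ∂μ := by
          gcongr
          exact enorm_sub_sq_le _ _ _
      _ = ∫⁻ x, ∫⁻ y, (2 * κ univ * ‖φ x - φ y‖ₑ ^ 2 +
            2 * ∫⁻ z, ‖φ y - φ z‖ₑ ^ 2 ∂κ) ∂ν ∂μ := by
          refine lintegral_congr fun x => lintegral_congr fun y => ?_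
          rw [lintegral_add_left measurable_const, lintegral_const,
            lintegral_const_mul _ (hmx y)]
          ring
      _ = ∫⁻ x, (2 * κ univ * ∫⁻ y, ‖φ x - φ y‖ₑ ^ 2 ∂ν +
            2 * ∫⁻ y, ∫⁻ z, ‖φ y - φ z‖ₑ ^ 2 ∂κ ∂ν) ∂μ := by
          refine lintegral_congr fun x => ?_
          rw [lintegral_add_left ((hmx x).const_mul _), lintegral_const_mul _ (hmx x),
            lintegral_const_mul _ (measurable_lintegral_enorm_sub_sq hφ _)]
      _ = 2 * κ univ * ∫⁻ x, ∫⁻ y, ‖φ x - φ y‖ₑ ^ 2 ∂ν ∂μ +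
            2 * (∫⁻ y, ∫⁻ z, ‖φ y - φ z‖ₑ ^ 2 ∂κ ∂ν) * μ univ := by
          rw [lintegral_add_right _ measurable_const, lintegral_const,
            lintegral_const_mul _ (measurable_lintegral_enorm_sub_sq hφ _)]
      _ ≤ 2 * κ univ * (C * energy Ω φ) + 2 * (D * energy Ω φ) * μ univ := by
          gcongr
          · exact hC φ hφ
          · exact hD φ hφ
      _ = _ := by ring
  rw [hc, mul_assoc]
  calc _ = (ν univ)⁻¹ * (ν univ * ∫⁻ x, ∫⁻ z, ‖φ x - φ z‖ₑ ^ 2 ∂κ ∂μ) := by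
        rw [← mul_assoc, ENNReal.inv_mul_cancel hν0 hνt, one_mul]
    _ ≤ _ := by gcongr

end PoincareRel

/-! ### Poincaré inequality on balls and along chains of balls -/

/-- Control of the increments of `φ` along a vector by the energy. -/
lemma lintegral_translate_sub_sq_le {Ω A : Set (E n)} (hΩ : MeasurableSet Ω) (h : E n)
    (hA : ∀ x ∈ A, ∀ t ∈ Ioc (0 : ℝ) 1, x + t • h ∈ Ω)
    {φ : E n → ℝ} (hφ : ContDiff ℝ 1 φ) :
    ∫⁻ x in A, ‖φ (x + h) - φ x‖ₑ ^ 2 ≤ ‖h‖ₑ ^ 2 * energy Ω φ := by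
  have hm : Measurable (fun x => ‖fderiv ℝ φ x‖ₑ ^ 2) := measurable_energy_density hφ
  have hmi := hm.indicator hΩ
  have hmp : Measurable fun p : E n × ℝ => Ω.indicator (fun x => ‖fderiv ℝ φ x‖ₑ ^ 2)
      (p.1 + p.2 • h) :=
    Measurable.comp (f := fun p : E n × ℝ => p.1 + p.2 • h) hmi (by fun_prop)
  have hmq : Measurable fun x : E n => ‖h‖ₑ ^ 2 * ∫⁻ t in Ioc (0 : ℝ) 1,
      Ω.indicator (fun x => ‖fderiv ℝ φ x‖ₑ ^ 2) (x + t • h) :=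
    Measurable.const_mul (Measurable.lintegral_prod_right' hmp) _
  calc ∫⁻ x in A, ‖φ (x + h) - φ x‖ₑ ^ 2
      ≤ ∫⁻ x in A, ‖h‖ₑ ^ 2 * ∫⁻ t in Ioc (0 : ℝ) 1,
          Ω.indicator (fun x => ‖fderiv ℝ φ x‖ₑ ^ 2) (x + t • h) := by
        refine setLIntegral_mono hmq fun x hx => ?_
        have := enorm_sub_sq_le_lintegral_fderiv hφ x h zero_le_one
        rw [one_smul, ENNReal.ofReal_one, one_mul] at this
        refine this.trans ?_
        refine mul_le_mul' le_rfl ?_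
        refine setLIntegral_mono' measurableSet_Ioc fun t ht => ?_
        rw [indicator_of_mem (hA x hx t ht)]
    -- The energy density is now cut off to `Ω`, so the integral over `A` can be enlarged to the
    -- whole space, where for each fixed `t` it is translation invariant.
    _ ≤ ∫⁻ x, ‖h‖ₑ ^ 2 * ∫⁻ t in Ioc (0 : ℝ) 1,
          Ω.indicator (fun x => ‖fderiv ℝ φ x‖ₑ ^ 2) (x + t • h) := setLIntegral_le_lintegral _ _
    _ = ‖h‖ₑ ^ 2 * ∫⁻ t in Ioc (0 : ℝ) 1, ∫⁻ x,
          Ω.indicator (fun x => ‖fderiv ℝ φ x‖ₑ ^ 2) (x + t • h) := by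
        rw [lintegral_const_mul _ (Measurable.lintegral_prod_right' hmp)]
        rw [lintegral_lintegral_swap hmp.aemeasurable]
    _ = ‖h‖ₑ ^ 2 * energy Ω φ := by
        simp_rw [lintegral_add_right_eq_self (μ := (volume : Measure (E n)))
          (Ω.indicator (fun x => ‖fderiv ℝ φ x‖ₑ ^ 2))]
        simp [energy, lintegral_indicator hΩ]

/-- Poincaré inequality on balls. -/
lemma poincareRel_ball_self {Ω : Set (E n)} (hΩ : IsOpen Ω) {x : E n} {r : ℝ}
    (hB : Metric.ball x r ⊆ Ω) :
    PoincareRel Ω (volume.restrict (Metric.ball x r)) (volume.restrict (Metric.ball x r)) := by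
  set B := Metric.ball x r with hBdef
  have hBm : MeasurableSet B := measurableSet_ball
  have hV : volume (Metric.ball (0 : E n) (2 * r)) ≠ ⊤ := measure_ball_lt_top.ne
  -- Two points of the ball differ by a vector `h` with `‖h‖ < 2r`. Each such `h` contributes at
  -- most `(2r)²` times the energy, and these vectors fill a ball of radius `2r`.
  obtain ⟨c, hc⟩ : ∃ c : ℝ≥0, (c : ℝ≥0∞) =
      ENNReal.ofReal (2 * r) ^ 2 * volume (Metric.ball (0 : E n) (2 * r)) :=
    exists_coe_eq (by finiteness)
  refine ⟨c, ?_⟩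
  intro φ hφ
  have hdiff : ∀ h : E n, ∫⁻ y in B ∩ {y | y + h ∈ B}, ‖φ (y + h) - φ y‖ₑ ^ 2 ≤
      (Metric.ball (0 : E n) (2 * r)).indicator
        (fun _ => ENNReal.ofReal (2 * r) ^ 2 * energy Ω φ) h := by
    intro h
    by_cases hh : h ∈ Metric.ball (0 : E n) (2 * r)
    · rw [indicator_of_mem hh]
      refine (lintegral_translate_sub_sq_le hΩ.measurableSet h ?_ hφ).trans ?_
      · rintro y ⟨hy, hy'⟩ t ht
        apply hB
        have := (convex_ball x r).add_smul_mem hy hy' ⟨ht.1.le, ht.2⟩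
        exact this
      · gcongr
        rw [← ofReal_norm]
        exact ENNReal.ofReal_le_ofReal (mem_ball_zero_iff.1 hh).le
    · have : B ∩ {y | y + h ∈ B} = ∅ := by
        ext y
        simp only [mem_inter_iff, mem_ofPred_eq, mem_empty_iff_false, iff_false, not_and]
        intro hy hy'
        apply hh
        rw [mem_ball_zero_iff]
        rw [hBdef, Metric.mem_ball] at hy hy'
        calc ‖h‖ = dist (y + h) y := by simp
          _ ≤ dist (y + h) x + dist y x := dist_triangle_right _ _ _
          _ < _ := by linarith
      rw [this]
      simp
  have hmJ : Measurable fun p : E n × E n =>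
      (B ×ˢ B).indicator (fun p : E n × E n => ‖φ p.1 - φ p.2‖ₑ ^ 2) (p.2 + p.1, p.2) :=
    Measurable.comp (f := fun p : E n × E n => (p.2 + p.1, p.2))
      ((measurable_enorm_sub_sq hφ measurable_fst measurable_snd).indicator (hBm.prod hBm))
      (by fun_prop)
  calc ∫⁻ a in B, ∫⁻ y in B, ‖φ a - φ y‖ₑ ^ 2
      = ∫⁻ y in B, ∫⁻ a in B, ‖φ a - φ y‖ₑ ^ 2 :=
        lintegral_lintegral_swap
          (measurable_enorm_sub_sq hφ measurable_fst measurable_snd).aemeasurable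
    _ = ∫⁻ y, ∫⁻ a, (B ×ˢ B).indicator (fun p : E n × E n => ‖φ p.1 - φ p.2‖ₑ ^ 2) (a, y) := by
        rw [← lintegral_indicator hBm]
        refine lintegral_congr fun y => ?_
        by_cases hy : y ∈ B
        · rw [indicator_of_mem hy, ← lintegral_indicator hBm]
          refine lintegral_congr fun a => ?_
          by_cases ha : a ∈ B
          · rw [indicator_of_mem ha, indicator_of_mem (show (a, y) ∈ B ×ˢ B from ⟨ha, hy⟩)]
          · rw [indicator_of_notMem ha, indicator_of_notMem fun h => ha h.1]
        · have : ∀ a, (a, y) ∉ B ×ˢ B := fun a ha => hy ha.2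
          simp [hy, this]
    -- Substitution `a = y + h`: the double integral becomes an integral over increments `h`.
    _ = ∫⁻ y, ∫⁻ h, (B ×ˢ B).indicator (fun p : E n × E n => ‖φ p.1 - φ p.2‖ₑ ^ 2)
          (y + h, y) := by
        refine lintegral_congr fun y => ?_
        rw [lintegral_add_left_eq_self (μ := (volume : Measure (E n)))
          (fun a => (B ×ˢ B).indicator (fun p : E n × E n => ‖φ p.1 - φ p.2‖ₑ ^ 2) (a, y))]
    _ = ∫⁻ h, ∫⁻ y, (B ×ˢ B).indicator (fun p : E n × E n => ‖φ p.1 - φ p.2‖ₑ ^ 2)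
          (y + h, y) :=
        (lintegral_lintegral_swap hmJ.aemeasurable).symm
    _ = ∫⁻ h, ∫⁻ y in B ∩ {y | y + h ∈ B}, ‖φ (y + h) - φ y‖ₑ ^ 2 := by
        refine lintegral_congr fun h => ?_
        have : MeasurableSet (B ∩ {y | y + h ∈ B}) :=
          hBm.inter (hBm.preimage (measurable_id.add_const h))
        rw [← lintegral_indicator this]
        refine lintegral_congr fun y => ?_
        by_cases ha : y ∈ B ∩ {y | y + h ∈ B}
        · rw [indicator_of_mem ha,
            indicator_of_mem (show (y + h, y) ∈ B ×ˢ B from ⟨ha.2, ha.1⟩)]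
        · rw [indicator_of_notMem ha, indicator_of_notMem fun h => ha ⟨h.2, h.1⟩]
    _ ≤ ∫⁻ h, (Metric.ball (0 : E n) (2 * r)).indicator
          (fun _ => ENNReal.ofReal (2 * r) ^ 2 * energy Ω φ) h := lintegral_mono hdiff
    _ = c * energy Ω φ := by
        rw [lintegral_indicator measurableSet_ball, lintegral_const, hc]
        simp only [Measure.restrict_apply, MeasurableSet.univ, univ_inter]
        ring

lemma restrict_ball_ne_zero (x : E n) {r : ℝ} (hr : 0 < r) :
    (volume : Measure (E n)).restrict (Metric.ball x r) ≠ 0 := by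
  rw [Ne, Measure.restrict_eq_zero]
  exact (Metric.measure_ball_pos _ _ hr).ne'

instance isFiniteMeasure_restrict_ball (x : E n) (r : ℝ) :
    IsFiniteMeasure ((volume : Measure (E n)).restrict (Metric.ball x r)) :=
  isFiniteMeasure_restrict.2 measure_ball_lt_top.ne

/-- Any two balls contained in a connected open set are related. -/
lemma poincareRel_ball {Ω : Set (E n)} (hΩ : IsOpen Ω) (hc : IsPreconnected Ω) {x y : E n}
    {r s : ℝ} (hr : 0 < r) (hs : 0 < s) (hx : Metric.ball x r ⊆ Ω) (hy : Metric.ball y s ⊆ Ω) :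
    PoincareRel Ω (volume.restrict (Metric.ball x r)) (volume.restrict (Metric.ball y s)) := by
  -- Quantifying over all admissible radii makes this a relation between centres only, to which
  -- induction on a preconnected set applies.
  let P : E n → E n → Prop := fun x y => ∀ r s : ℝ, 0 < r → 0 < s → Metric.ball x r ⊆ Ω →
    Metric.ball y s ⊆ Ω →
    PoincareRel Ω (volume.restrict (Metric.ball x r)) (volume.restrict (Metric.ball y s))
  have hsub : ∀ {x y : E n} {r s : ℝ}, 0 < s → Metric.ball x r ⊆ Ω →
      Metric.ball y s ⊆ Metric.ball x r →
      PoincareRel Ω (volume.restrict (Metric.ball x r)) (volume.restrict (Metric.ball y s)) :=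
    fun _ hr hsr => ((poincareRel_ball_self hΩ hr).mono_restrict hsr).symm
  have hself : ∀ x : E n, ∀ r s : ℝ, 0 < r → 0 < s → Metric.ball x r ⊆ Ω →
      Metric.ball x s ⊆ Ω →
      PoincareRel Ω (volume.restrict (Metric.ball x r)) (volume.restrict (Metric.ball x s)) := by
    intro x r s hr hs hxr hxs
    rcases le_total s r with h | h
    · exact hsub hs hxr (Metric.ball_subset_ball h)
    · exact (hsub hr hxs (Metric.ball_subset_ball h)).symm
  refine hc.induction₂ P ?_ ?_ ?_ (hx (Metric.mem_ball_self hr))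
    (hy (Metric.mem_ball_self hs)) r s hr hs hx hy
  · intro x hx
    obtain ⟨R, hR, hRΩ⟩ := Metric.isOpen_iff.1 hΩ x hx
    filter_upwards [mem_nhdsWithin_of_mem_nhds (Metric.ball_mem_nhds x hR)] with y hy r s hr hs
      hxr hys
    obtain ⟨δ, hδ, hδR⟩ := Metric.isOpen_iff.1 Metric.isOpen_ball y hy
    -- The chain is `B(x, r)`, `B(x, R)`, `B(y, δ)`, `B(y, s)`; consecutive balls are nested one way
    -- or the other.
    have h₁ := hself x r R hr hR hxr hRΩ
    have h₂ := hsub hδ hRΩ hδR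
    have h₃ := hself y δ s hδ hs (hδR.trans hRΩ) hys
    exact (h₁.trans h₂ (restrict_ball_ne_zero x hR)).trans h₃ (restrict_ball_ne_zero y hδ)
  · intro x y z _ hy _ hxy hyz r s hr hs hxr hzs
    obtain ⟨R, hR, hRΩ⟩ := Metric.isOpen_iff.1 hΩ y hy
    exact (hxy r R hr hR hxr hRΩ).trans (hyz R s hR hs hRΩ hzs) (restrict_ball_ne_zero y hR)
  · intro x y _ _ hxy r s hr hs hxr hys
    exact (hxy s r hs hr hys hxr).symm

/-! ### Lipschitz images and transport of the relation -/

lemma euclideanHausdorffMeasure_image_le {X Y : Type*} [EMetricSpace X] [MeasurableSpace X]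
    [BorelSpace X] [EMetricSpace Y] [MeasurableSpace Y] [BorelSpace Y] {f : X → Y} {K : ℝ≥0}
    (hf : LipschitzWith K f) (d : ℕ) (s : Set X) :
    μHE[d] (f '' s) ≤ (K : ℝ≥0∞) ^ d * μHE[d] s := by
  simp only [Measure.euclideanHausdorffMeasure_def, Measure.smul_apply, ENNReal.smul_def,
    smul_eq_mul]
  rw [mul_left_comm]
  gcongr
  simpa using hf.hausdorffMeasure_image_le (d := (d : ℝ)) (by positivity) s

/-- If the points of `ν` are reached from those of `μ` along a family of pairs `(p a, q a)` with
increments controlled by the energy, a relation for `ν` is transported to `μ`. -/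
lemma PoincareRel.transport {Ω : Set (E n)} {α : Type*} [MeasurableSpace α] {m : Measure α}
    {p q : α → E n} (hp : Measurable p) (hq : Measurable q) {ν κ : Measure (E n)}
    [IsFiniteMeasure κ] {c c' : ℝ≥0} (hν : m.map q ≤ c' • ν)
    (hpq : ∀ φ : E n → ℝ, ContDiff ℝ 1 φ →
      ∫⁻ a, ‖φ (p a) - φ (q a)‖ₑ ^ 2 ∂m ≤ c * energy Ω φ)
    (h : PoincareRel Ω ν κ) : PoincareRel Ω (m.map p) κ := by
  obtain ⟨C, hC⟩ := h
  obtain ⟨k, hk⟩ := exists_coe_eq (measure_ne_top κ univ)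
  refine ⟨2 * k * c + 2 * (c' * C), ?_⟩
  intro φ hφ
  have hmx : ∀ x : E n, Measurable fun z => ‖φ x - φ z‖ₑ ^ 2 := fun x =>
    measurable_enorm_sub_sq hφ measurable_const measurable_id
  have hI := measurable_lintegral_enorm_sub_sq hφ κ
  have hIq : Measurable fun a => ∫⁻ z, ‖φ (q a) - φ z‖ₑ ^ 2 ∂κ := hI.comp hq
  have hpqm := measurable_enorm_sub_sq hφ hp hq
  rw [lintegral_map hI hp]
  calc ∫⁻ a, ∫⁻ y, ‖φ (p a) - φ y‖ₑ ^ 2 ∂κ ∂m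
      ≤ ∫⁻ a, ∫⁻ y, (2 * ‖φ (p a) - φ (q a)‖ₑ ^ 2 + 2 * ‖φ (q a) - φ y‖ₑ ^ 2) ∂κ ∂m := by
        gcongr
        exact enorm_sub_sq_le _ _ _
    _ = ∫⁻ a, (2 * κ univ * ‖φ (p a) - φ (q a)‖ₑ ^ 2 +
          2 * ∫⁻ y, ‖φ (q a) - φ y‖ₑ ^ 2 ∂κ) ∂m := by
        refine lintegral_congr fun a => ?_
        rw [lintegral_add_left measurable_const, lintegral_const, lintegral_const_mul _ (hmx _)]
        ring
    _ = 2 * κ univ * ∫⁻ a, ‖φ (p a) - φ (q a)‖ₑ ^ 2 ∂m +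
          2 * ∫⁻ a, ∫⁻ y, ‖φ (q a) - φ y‖ₑ ^ 2 ∂κ ∂m := by
        rw [lintegral_add_left (hpqm.const_mul _), lintegral_const_mul _ hpqm,
          lintegral_const_mul _ hIq]
    _ ≤ 2 * κ univ * (c * energy Ω φ) + 2 * (c' * (C * energy Ω φ)) := by
        gcongr
        · exact hpq φ hφ
        · rw [← lintegral_map (f := fun x => ∫⁻ z, ‖φ x - φ z‖ₑ ^ 2 ∂κ) hI hq]
          refine (lintegral_le_of_le_smul hν _).trans ?_
          gcongr
          exact hC φ hφ
    _ = _ := by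
        rw [← hk]
        push_cast
        ring

/-! ### Local graph coordinates at the boundary -/

/-- In the ball of radius `r` around the boundary point `x₀` the set `Ω` lies above the graph
of `γ`, in the orthogonal coordinates `Φ`. -/
structure IsLocalGraph (Ω : Set (E n)) (x₀ : E n) (Φ : E n ≃ₗᵢ[ℝ] WithLp 2 (E (n - 1) × ℝ))
    (γ : E (n - 1) → ℝ) (K : ℝ≥0) (r : ℝ) : Prop where
  isOpen : IsOpen Ω
  mem_frontier : x₀ ∈ frontier Ω
  lipschitz : LipschitzWith K γ
  mem_iff : ∀ x ∈ Metric.ball x₀ r, x ∈ Ω ↔ γ (Φ x).fst < (Φ x).snd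

section Coordinates

variable (Φ : E n ≃ₗᵢ[ℝ] WithLp 2 (E (n - 1) × ℝ))

/-- The vertical unit vector of the coordinates `Φ`. -/
def vertical : E n := Φ.symm (WithLp.toLp 2 (0, 1))

lemma norm_vertical : ‖vertical Φ‖ = 1 := by
  rw [vertical, LinearIsometryEquiv.norm_map]
  simp

@[simp]
lemma fst_add_vertical (x : E n) (s : ℝ) : (Φ (x + s • vertical Φ)).fst = (Φ x).fst := by
  simp [vertical]

@[simp]
lemma snd_add_vertical (x : E n) (s : ℝ) : (Φ (x + s • vertical Φ)).snd = (Φ x).snd + s := by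
  simp [vertical]

lemma norm_fst_le (x : WithLp 2 (E (n - 1) × ℝ)) : ‖x.fst‖ ≤ ‖x‖ := by
  refine abs_le_of_sq_le_sq' ?_ (norm_nonneg _) |>.2
  rw [WithLp.prod_norm_sq_eq_of_L2]
  nlinarith [sq_nonneg ‖x.snd‖]

lemma norm_snd_le (x : WithLp 2 (E (n - 1) × ℝ)) : ‖x.snd‖ ≤ ‖x‖ := by
  refine abs_le_of_sq_le_sq' ?_ (norm_nonneg _) |>.2
  rw [WithLp.prod_norm_sq_eq_of_L2]
  nlinarith [sq_nonneg ‖x.fst‖]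

lemma norm_le_fst_add_snd (x : WithLp 2 (E (n - 1) × ℝ)) : ‖x‖ ≤ ‖x.fst‖ + ‖x.snd‖ := by
  refine abs_le_of_sq_le_sq' ?_ (by positivity) |>.2
  rw [WithLp.prod_norm_sq_eq_of_L2]
  nlinarith [mul_nonneg (norm_nonneg x.fst) (norm_nonneg x.snd)]

lemma dist_fst_le (x y : E n) : dist (Φ x).fst (Φ y).fst ≤ dist x y := by
  rw [← Φ.dist_map x y, dist_eq_norm, dist_eq_norm, ← WithLp.sub_fst]
  exact norm_fst_le _

lemma dist_snd_le (x y : E n) : dist (Φ x).snd (Φ y).snd ≤ dist x y := by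
  rw [← Φ.dist_map x y, dist_eq_norm, dist_eq_norm, ← WithLp.sub_snd]
  exact norm_snd_le _

lemma dist_le_fst_add_snd (x y : E n) :
    dist x y ≤ dist (Φ x).fst (Φ y).fst + dist (Φ x).snd (Φ y).snd := by
  rw [← Φ.dist_map x y, dist_eq_norm, dist_eq_norm, dist_eq_norm, ← WithLp.sub_snd,
    ← WithLp.sub_fst]
  exact norm_le_fst_add_snd _

lemma dist_add_vertical (x : E n) (s : ℝ) : dist (x + s • vertical Φ) x = |s| := by
  simp [norm_smul, norm_vertical]

/-- The parametrization of the graph of `γ` by the horizontal coordinates. -/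
def graphMap (γ : E (n - 1) → ℝ) (y : E (n - 1)) : E n := Φ.symm (WithLp.toLp 2 (y, γ y))

@[simp]
lemma apply_graphMap (γ : E (n - 1) → ℝ) (y : E (n - 1)) :
    Φ (graphMap Φ γ y) = WithLp.toLp 2 (y, γ y) := by simp [graphMap]

lemma lipschitzWith_graphMap {γ : E (n - 1) → ℝ} {K : ℝ≥0} (hγ : LipschitzWith K γ) :
    LipschitzWith (1 + K) (graphMap Φ γ) := by
  refine LipschitzWith.of_dist_le_mul fun x y => ?_
  refine (dist_le_fst_add_snd Φ _ _).trans ?_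
  simp only [apply_graphMap, NNReal.coe_add, NNReal.coe_one, add_mul, one_mul]
  exact add_le_add le_rfl (hγ.dist_le_mul x y)

lemma graphMap_eq {γ : E (n - 1) → ℝ} {x : E n} (hx : (Φ x).snd = γ (Φ x).fst) :
    graphMap Φ γ (Φ x).fst = x := by
  rw [graphMap, ← hx]
  exact Φ.symm_apply_apply x

/-- The Cavalieri principle in the coordinates obtained by sliding the graph of `γ` vertically. -/
lemma lintegral_graphMap_add_vertical (γ : E (n - 1) → ℝ) {f : E n → ℝ≥0∞}
    (hf : Measurable f) :
    ∫⁻ y, ∫⁻ s : ℝ, f (graphMap Φ γ y + s • vertical Φ) = ∫⁻ x, f x := by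
  have hmp : MeasurePreserving (fun p : E (n - 1) × ℝ => Φ.symm (WithLp.toLp 2 p)) :=
    Φ.symm.measurePreserving.comp (WithLp.volume_preserving_toLp _ _)
  have hfm : Measurable fun p : E (n - 1) × ℝ => f (Φ.symm (WithLp.toLp 2 p)) :=
    hf.comp hmp.measurable
  rw [← hmp.lintegral_comp hf, Measure.volume_eq_prod, lintegral_prod _ hfm.aemeasurable]
  refine lintegral_congr fun y => ?_
  -- The shear `(y, s) ↦ (y, γ y + s)` is a translation on each vertical fibre, so it preserves
  -- volume without any derivative of `γ`.
  rw [← lintegral_add_left_eq_self (fun s => f (Φ.symm (WithLp.toLp 2 (y, s)))) (γ y)]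
  refine lintegral_congr fun s => congrArg f ?_
  apply Φ.injective
  simp only [map_add, map_smul, apply_graphMap, vertical, LinearIsometryEquiv.apply_symm_apply]
  apply WithLp.ofLp_injective
  simp

end Coordinates

namespace IsLocalGraph

variable {Ω : Set (E n)} {x₀ : E n} {Φ : E n ≃ₗᵢ[ℝ] WithLp 2 (E (n - 1) × ℝ)}
  {γ : E (n - 1) → ℝ} {K : ℝ≥0} {r : ℝ}

lemma continuous_fst (Φ : E n ≃ₗᵢ[ℝ] WithLp 2 (E (n - 1) × ℝ)) :
    Continuous fun x => (Φ x).fst :=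
  (LipschitzWith.of_dist_le_mul (K := 1) fun x y => by simpa using dist_fst_le Φ x y).continuous

lemma continuous_snd (Φ : E n ≃ₗᵢ[ℝ] WithLp 2 (E (n - 1) × ℝ)) :
    Continuous fun x => (Φ x).snd :=
  (LipschitzWith.of_dist_le_mul (K := 1) fun x y => by simpa using dist_snd_le Φ x y).continuous

lemma le_snd_of_mem_closure (hg : IsLocalGraph Ω x₀ Φ γ K r) {x : E n} (hx : x ∈ closure Ω)
    (hxr : x ∈ Metric.ball x₀ r) : γ (Φ x).fst ≤ (Φ x).snd := by
  by_contra! h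
  have hU : IsOpen (Metric.ball x₀ r ∩ {y | (Φ y).snd < γ (Φ y).fst}) :=
    Metric.isOpen_ball.inter (isOpen_lt (continuous_snd Φ)
      (hg.lipschitz.continuous.comp (continuous_fst Φ)))
  obtain ⟨y, ⟨hy, hy'⟩, hyΩ⟩ := mem_closure_iff.1 hx _ hU ⟨hxr, h⟩
  exact lt_asymm ((hg.mem_iff y hy).1 hyΩ) hy'

lemma snd_eq_of_mem_frontier (hg : IsLocalGraph Ω x₀ Φ γ K r) {x : E n} (hx : x ∈ frontier Ω)
    (hxr : x ∈ Metric.ball x₀ r) : (Φ x).snd = γ (Φ x).fst := by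
  refine le_antisymm (not_lt.1 fun h => ?_) (hg.le_snd_of_mem_closure hx.1 hxr)
  have := (hg.mem_iff x hxr).2 h
  rw [hg.isOpen.frontier_eq] at hx
  exact hx.2 this

/-- The weak inequality in `hx` admits points on the graph itself; the strict one needed for `Ω` is
supplied by `0 < s`. -/
lemma add_vertical_mem (hg : IsLocalGraph Ω x₀ Φ γ K r) {x : E n} {s : ℝ} (hs : 0 < s)
    (hx : γ (Φ x).fst ≤ (Φ x).snd) (hxs : dist x x₀ + s < r) : x + s • vertical Φ ∈ Ω := by
  rw [hg.mem_iff]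
  · simp only [fst_add_vertical, snd_add_vertical]
    linarith
  · rw [Metric.mem_ball]
    calc _ ≤ dist (x + s • vertical Φ) x + dist x x₀ := dist_triangle _ _ _
      _ < r := by rw [dist_add_vertical, abs_of_pos hs]; linarith

lemma mem_frontier_of_snd_eq (hg : IsLocalGraph Ω x₀ Φ γ K r) {x : E n}
    (hx : (Φ x).snd = γ (Φ x).fst) (hxr : x ∈ Metric.ball x₀ r) : x ∈ frontier Ω := by
  rw [hg.isOpen.frontier_eq]
  refine ⟨?_, fun h => ?_⟩
  · have hlim : Tendsto (fun s : ℝ => x + s • vertical Φ) (𝓝[>] 0) (𝓝 x) := by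
      have hc : Continuous fun s : ℝ => x + s • vertical Φ := by fun_prop
      have := hc.tendsto 0
      simp only [zero_smul, add_zero] at this
      exact this.mono_left nhdsWithin_le_nhds
    refine mem_closure_of_tendsto hlim ?_
    have hr : 0 < r - dist x x₀ := by
      rw [Metric.mem_ball] at hxr
      linarith
    filter_upwards [Ioo_mem_nhdsGT hr] with s hs
    exact hg.add_vertical_mem hs.1 hx.ge (by linarith [hs.2])
  · exact absurd hx ((hg.mem_iff x hxr).1 h).ne'

/-- Within distance `ρ` of the raised centre a point drops by less than `ρ` and the graph rises by
at most `K * ρ`, so a height above `(1 + K) * ρ` suffices. The bound `h + ρ ≤ r` keeps the ball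
inside the chart. -/
lemma ball_add_vertical_subset (hg : IsLocalGraph Ω x₀ Φ γ K r) {ρ h : ℝ} (hρ : 0 < ρ)
    (hh : (1 + K) * ρ < h) (hr : h + ρ ≤ r) : Metric.ball (x₀ + h • vertical Φ) ρ ⊆ Ω := by
  intro x hx
  have hK : 0 ≤ (K : ℝ) := K.2
  have hh0 : 0 < h := lt_trans (by positivity) hh
  have hx₀ := hg.snd_eq_of_mem_frontier hg.mem_frontier (Metric.mem_ball_self (by linarith))
  rw [Metric.mem_ball] at hx
  rw [hg.mem_iff]
  · have h1 := (dist_fst_le Φ x (x₀ + h • vertical Φ)).trans_lt hx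
    have h2 := (dist_snd_le Φ x (x₀ + h • vertical Φ)).trans_lt hx
    rw [fst_add_vertical] at h1
    rw [snd_add_vertical, Real.dist_eq] at h2
    have h3 := hg.lipschitz.dist_le_mul (Φ x).fst (Φ x₀).fst
    rw [Real.dist_eq] at h3
    have h4 : (K : ℝ) * dist (Φ x).fst (Φ x₀).fst ≤ K * ρ := by gcongr
    have h5 := (abs_le.1 (h3.trans h4)).2
    have h6 := (abs_lt.1 h2).1
    linarith
  · rw [Metric.mem_ball]
    calc _ ≤ dist x (x₀ + h • vertical Φ) + dist (x₀ + h • vertical Φ) x₀ := dist_triangle _ _ _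
      _ < ρ + h := by
        rw [dist_add_vertical, abs_of_pos hh0]
        linarith
      _ ≤ r := by linarith

/-- The piece of `Ω` at the boundary is slid up by `h` into a ball contained in `Ω`. Translation
preserves volume, and the path stays above the graph, hence in `Ω`. -/
lemma poincareRel_inter_ball (hg : IsLocalGraph Ω x₀ Φ γ K r) {ρ h : ℝ} (hρ : 0 < ρ)
    (hh : (1 + K) * ρ < h) (hr : h + ρ ≤ r) :
    PoincareRel Ω (volume.restrict (Ω ∩ Metric.ball x₀ ρ))
      (volume.restrict (Metric.ball (x₀ + h • vertical Φ) ρ)) := by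
  have hh0 : 0 < h := lt_trans (by have := K.2; positivity) hh
  have hself := poincareRel_ball_self hg.isOpen (hg.ball_add_vertical_subset hρ hh hr)
  have hmq : Measurable fun x : E n => x + h • vertical Φ := measurable_id.add_const _
  have key := hself.transport (m := volume.restrict (Ω ∩ Metric.ball x₀ ρ)) (p := id)
    (q := fun x => x + h • vertical Φ) (c := (‖h • vertical Φ‖₊) ^ 2) (c' := 1)
    measurable_id hmq ?_ ?_
  · rwa [Measure.map_id] at key
  · rw [one_smul, Measure.le_iff]
    intro T hT
    rw [Measure.map_apply hmq hT, Measure.restrict_apply (hmq hT), Measure.restrict_apply hT]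
    rw [← measure_preimage_add_right volume (h • vertical Φ)
      (T ∩ Metric.ball (x₀ + h • vertical Φ) ρ)]
    refine measure_mono fun x hx => ⟨hx.1, ?_⟩
    simpa using hx.2.2
  · intro φ hφ
    simp only [id, enorm_sub_rev (φ _) (φ (_ + _))]
    refine (lintegral_translate_sub_sq_le hg.isOpen.measurableSet _ ?_ hφ).trans ?_
    · rintro x ⟨hxΩ, hx⟩ t ht
      rw [smul_smul]
      rw [Metric.mem_ball] at hx
      have hth : t * h ≤ h := by nlinarith [ht.2]
      refine hg.add_vertical_mem (mul_pos ht.1 hh0) ?_ (by linarith)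
      exact ((hg.mem_iff x (Metric.mem_ball.2 (by linarith))).1 hxΩ).le
    · simp [enorm]

lemma surfaceMeasure_restrict_ball (Ω : Set (E n)) (x₀ : E n) (ρ : ℝ) :
    (surfaceMeasure Ω).restrict (Metric.ball x₀ ρ) =
      (μHE[n - 1] : Measure (E n)).restrict (Metric.ball x₀ ρ ∩ frontier Ω) := by
  rw [surfaceMeasure, Measure.restrict_restrict measurableSet_ball]

/-- Inside the chart the graph map inverts the horizontal projection on the boundary, so `T` is
contained in the `(1 + K)`-Lipschitz image of its parameter set. -/
lemma measure_le_of_subset_frontier (hg : IsLocalGraph Ω x₀ Φ γ K r) {T : Set (E n)}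
    (hT : T ⊆ Metric.ball x₀ r ∩ frontier Ω) :
    (μHE[n - 1] : Measure (E n)) T ≤
      ((1 + K : ℝ≥0) : ℝ≥0∞) ^ (n - 1) * volume (graphMap Φ γ ⁻¹' T) := by
  have hsub : T ⊆ graphMap Φ γ '' (graphMap Φ γ ⁻¹' T) := by
    intro x hx
    have := graphMap_eq Φ (hg.snd_eq_of_mem_frontier (hT hx).2 (hT hx).1)
    refine ⟨(Φ x).fst, ?_, this⟩
    rwa [mem_preimage, this]
  refine (measure_mono hsub).trans ?_
  rw [← EuclideanSpace.euclideanHausdorffMeasure_eq_volume]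
  exact euclideanHausdorffMeasure_image_le (lipschitzWith_graphMap Φ hg.lipschitz) _ _

lemma surfaceMeasure_restrict_le (hg : IsLocalGraph Ω x₀ Φ γ K r) :
    (surfaceMeasure Ω).restrict (Metric.ball x₀ r) ≤
      ((1 + K) ^ (n - 1) : ℝ≥0) • (volume : Measure (E (n - 1))).map (graphMap Φ γ) := by
  have hm : Measurable (graphMap Φ γ) :=
    (lipschitzWith_graphMap Φ hg.lipschitz).continuous.measurable
  rw [Measure.le_iff]
  intro T hT
  rw [surfaceMeasure_restrict_ball, Measure.restrict_apply hT, Measure.smul_apply,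
    Measure.map_apply hm hT]
  refine (hg.measure_le_of_subset_frontier inter_subset_right).trans ?_
  rw [ENNReal.smul_def, smul_eq_mul, ENNReal.coe_pow]
  gcongr
  exact inter_subset_left

lemma surfaceMeasure_ball_lt_top (hg : IsLocalGraph Ω x₀ Φ γ K r) :
    surfaceMeasure Ω (Metric.ball x₀ r) < ⊤ := by
  rw [surfaceMeasure, Measure.restrict_apply measurableSet_ball]
  refine (hg.measure_le_of_subset_frontier le_rfl).trans_lt ?_
  refine ENNReal.mul_lt_top (by finiteness) ?_
  refine (measure_mono (t := Metric.ball (Φ x₀).fst r) fun y hy => ?_).trans_lt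
    measure_ball_lt_top
  have := (dist_fst_le Φ (graphMap Φ γ y) x₀).trans_lt hy.1
  simpa using this

/-- The horizontal projection is 1-Lipschitz and so does not increase the measure, while the
projected boundary piece contains a ball of radius `ρ / (1 + K)` because `graphMap` is `(1 +
K)`-Lipschitz. -/
lemma surfaceMeasure_ball_pos (hg : IsLocalGraph Ω x₀ Φ γ K r) {ρ : ℝ} (hρ : 0 < ρ)
    (hr : ρ ≤ r) : 0 < surfaceMeasure Ω (Metric.ball x₀ ρ) := by
  have hK : 0 ≤ (K : ℝ) := K.2
  rw [surfaceMeasure, Measure.restrict_apply measurableSet_ball]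
  have hx₀ := hg.snd_eq_of_mem_frontier hg.mem_frontier (Metric.mem_ball_self (by linarith))
  have hproj : LipschitzWith 1 fun x => (Φ x).fst :=
    LipschitzWith.of_dist_le_mul fun x y => by simpa using dist_fst_le Φ x y
  have hsub : Metric.ball (Φ x₀).fst (ρ / (1 + K)) ⊆
      (fun x => (Φ x).fst) '' (Metric.ball x₀ ρ ∩ frontier Ω) := by
    intro y hy
    have hmem : graphMap Φ γ y ∈ Metric.ball x₀ ρ := by
      have := (lipschitzWith_graphMap Φ hg.lipschitz).dist_le_mul y (Φ x₀).fst
      rw [graphMap_eq Φ hx₀] at this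
      rw [Metric.mem_ball] at hy ⊢
      refine this.trans_lt ?_
      rw [lt_div_iff₀ (by positivity)] at hy
      push_cast
      linarith
    exact ⟨graphMap Φ γ y, ⟨hmem, hg.mem_frontier_of_snd_eq (by simp)
      (Metric.ball_subset_ball hr hmem)⟩, by simp⟩
  have h1 := euclideanHausdorffMeasure_image_le hproj (n - 1) (Metric.ball x₀ ρ ∩ frontier Ω)
  rw [EuclideanSpace.euclideanHausdorffMeasure_eq_volume] at h1
  simp only [ENNReal.coe_one, one_pow, one_mul] at h1
  exact (Metric.measure_ball_pos volume _ (by positivity)).trans_le ((measure_mono hsub).trans h1)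

/-- The layer of height `h` above a piece of the boundary has a bounded density. -/
lemma map_add_vertical_le (hg : IsLocalGraph Ω x₀ Φ γ K r) {ρ h : ℝ} (hr : ρ + h < r) (hh : 0 < h) :
    (((surfaceMeasure Ω).restrict (Metric.ball x₀ ρ)).prod (volume.restrict (Ioc 0 h))).map
      (fun a : E n × ℝ => a.1 + a.2 • vertical Φ) ≤
      ((1 + K) ^ (n - 1) : ℝ≥0) • volume.restrict (Ω ∩ Metric.ball x₀ (ρ + h)) := by
  have hmq : Measurable fun a : E n × ℝ => a.1 + a.2 • vertical Φ := by fun_prop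
  have hA : MeasurableSet (Ω ∩ Metric.ball x₀ (ρ + h)) :=
    hg.isOpen.measurableSet.inter measurableSet_ball
  have hm : Measurable (graphMap Φ γ) :=
    (lipschitzWith_graphMap Φ hg.lipschitz).continuous.measurable
  rw [Measure.le_iff]
  intro T hT
  rw [Measure.map_apply hmq hT, Measure.prod_apply (hmq hT), Measure.smul_apply,
    Measure.restrict_apply hT]
  set B := T ∩ (Ω ∩ Metric.ball x₀ (ρ + h)) with hB
  have hBm : MeasurableSet B := hT.inter hA
  have hfm : Measurable fun a : E n × ℝ =>
      B.indicator (1 : E n → ℝ≥0∞) (a.1 + a.2 • vertical Φ) :=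
    Measurable.comp (f := fun a : E n × ℝ => a.1 + a.2 • vertical Φ)
      (measurable_one.indicator hBm) hmq
  have hFm : Measurable fun x : E n =>
      ∫⁻ s : ℝ, B.indicator (1 : E n → ℝ≥0∞) (x + s • vertical Φ) :=
    hfm.lintegral_prod_right'
  have hle : (surfaceMeasure Ω).restrict (Metric.ball x₀ ρ) ≤
      (surfaceMeasure Ω).restrict (Metric.ball x₀ r) :=
    Measure.restrict_mono (Metric.ball_subset_ball (by linarith)) le_rfl
  -- Raised boundary points land in `Ω` near `x₀`, so the heights in `(0, h]` may be replaced by all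
  -- real heights with the indicator of `B`. Surface measure is then dominated by the pushforward
  -- under `graphMap`, and Cavalieri gives the volume of `B`.
  calc _ ≤ ∫⁻ x in Metric.ball x₀ ρ,
        (∫⁻ s : ℝ, B.indicator (1 : E n → ℝ≥0∞) (x + s • vertical Φ)) ∂surfaceMeasure Ω := by
        rw [surfaceMeasure_restrict_ball]
        refine setLIntegral_mono hFm fun x hx => ?_
        have hpre : MeasurableSet
            (Prod.mk x ⁻¹' ((fun a : E n × ℝ => a.1 + a.2 • vertical Φ) ⁻¹' T)) :=
          measurable_prodMk_left (hmq hT)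
        rw [Measure.restrict_apply hpre, ← lintegral_indicator_one (hpre.inter measurableSet_Ioc)]
        refine lintegral_mono fun s => ?_
        by_cases hs :
            s ∈ Prod.mk x ⁻¹' ((fun a : E n × ℝ => a.1 + a.2 • vertical Φ) ⁻¹' T) ∩ Ioc 0 h
        · have hxs : x + s • vertical Φ ∈ B := by
            have hxρ := Metric.mem_ball.1 hx.1
            have hsh : s ≤ h := hs.2.2
            refine ⟨hs.1, hg.add_vertical_mem hs.2.1 ?_ (by linarith), ?_⟩
            · exact hg.le_snd_of_mem_closure hx.2.1 (Metric.mem_ball.2 (by linarith))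
            · rw [Metric.mem_ball]
              have h1 := dist_triangle (x + s • vertical Φ) x x₀
              rw [dist_add_vertical, abs_of_pos hs.2.1] at h1
              linarith
          rw [indicator_of_mem hs, indicator_of_mem hxs]
          simp
        · rw [indicator_of_notMem hs]
          exact zero_le
    _ ≤ ((1 + K) ^ (n - 1) : ℝ≥0) * ∫⁻ x, (∫⁻ s : ℝ, B.indicator (1 : E n → ℝ≥0∞)
          (x + s • vertical Φ)) ∂((volume : Measure (E (n - 1))).map (graphMap Φ γ)) :=
        lintegral_le_of_le_smul (hle.trans hg.surfaceMeasure_restrict_le) _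
    _ = _ := by
        rw [ENNReal.smul_def, smul_eq_mul, lintegral_map hFm hm,
          lintegral_graphMap_add_vertical Φ γ
            (measurable_one.indicator hBm), lintegral_indicator_one hBm]

/-- Each boundary value is compared with the values at all heights `s ∈ (0, h]` above it. Averaging
over `s` replaces surface measure by a layer of bounded density in `Ω`; this is the core of the
trace inequality. -/
lemma poincareRel_surface (hg : IsLocalGraph Ω x₀ Φ γ K r) {ρ h : ℝ} (hr : ρ + h < r) (hh : 0 < h)
    {κ : Measure (E n)} [IsFiniteMeasure κ]
    (hκ : PoincareRel Ω (volume.restrict (Ω ∩ Metric.ball x₀ (ρ + h))) κ) :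
    PoincareRel Ω ((surfaceMeasure Ω).restrict (Metric.ball x₀ ρ)) κ := by
  have hfin : IsFiniteMeasure ((surfaceMeasure Ω).restrict (Metric.ball x₀ ρ)) :=
    isFiniteMeasure_restrict.2 ((measure_mono (Metric.ball_subset_ball (by linarith))).trans_lt
      hg.surfaceMeasure_ball_lt_top).ne
  have hmq : Measurable fun a : E n × ℝ => a.1 + a.2 • vertical Φ := by fun_prop
  have hle := hg.map_add_vertical_le hr hh
  have key := hκ.transport
    -- In `c`, one factor `h` comes from Cauchy–Schwarz on the vertical segment, the other from
    -- integrating over `s`; the power of `1 + K` is the density of the layer.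
    (m := ((surfaceMeasure Ω).restrict (Metric.ball x₀ ρ)).prod (volume.restrict (Ioc 0 h)))
    (p := Prod.fst) (c := (h.toNNReal * h.toNNReal) * (1 + K) ^ (n - 1)) measurable_fst hmq hle ?_
  · rw [Measure.map_fst_prod] at key
    -- The first marginal of the product is `h` times the surface measure.
    refine key.mono_left (c := h.toNNReal⁻¹) ?_
    have hv : (volume.restrict (Ioc 0 h)) univ = (h.toNNReal : ℝ≥0∞) := by
      simp [ENNReal.ofReal]
    rw [hv, ← ENNReal.smul_def, smul_smul, inv_mul_cancel₀ (by simpa using hh), one_smul]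
  · intro φ hφ
    have hmf := measurable_energy_density hφ
    have hmc : Measurable fun a : E n × ℝ => ‖fderiv ℝ φ (a.1 + a.2 • vertical Φ)‖ₑ ^ 2 :=
      Measurable.comp (f := fun a : E n × ℝ => a.1 + a.2 • vertical Φ) hmf hmq
    have hmd := measurable_enorm_sub_sq hφ (measurable_fst (α := E n) (β := ℝ)) hmq
    rw [lintegral_prod _ hmd.aemeasurable]
    calc _ ≤ ∫⁻ x in Metric.ball x₀ ρ, (∫⁻ _s in Ioc 0 h, ENNReal.ofReal h *
          ∫⁻ t in Ioc 0 h, ‖fderiv ℝ φ (x + t • vertical Φ)‖ₑ ^ 2) ∂surfaceMeasure Ω := by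
          refine lintegral_mono fun x => setLIntegral_mono measurable_const fun s hs => ?_
          have h1 := enorm_sub_sq_le_lintegral_fderiv hφ x (vertical Φ) hs.1.le
          have he : ‖vertical Φ‖ₑ = 1 := by rw [← ofReal_norm, norm_vertical]; simp
          rw [he, one_pow, mul_one, enorm_sub_rev] at h1
          refine h1.trans ?_
          gcongr
          · exact hs.2
          · exact hs.2
      _ = ENNReal.ofReal h * ENNReal.ofReal h * ∫⁻ x in Metric.ball x₀ ρ,
          (∫⁻ t in Ioc 0 h, ‖fderiv ℝ φ (x + t • vertical Φ)‖ₑ ^ 2) ∂surfaceMeasure Ω := by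
          rw [← lintegral_const_mul _ hmc.lintegral_prod_right']
          refine lintegral_congr fun x => ?_
          rw [setLIntegral_const, Real.volume_Ioc, sub_zero]
          ring
      _ = ENNReal.ofReal h * ENNReal.ofReal h * ∫⁻ z, ‖fderiv ℝ φ z‖ₑ ^ 2
          ∂((((surfaceMeasure Ω).restrict (Metric.ball x₀ ρ)).prod
            (volume.restrict (Ioc 0 h))).map (fun a : E n × ℝ => a.1 + a.2 • vertical Φ)) := by
          rw [lintegral_map hmf hmq, lintegral_prod _ hmc.aemeasurable]
      _ ≤ ENNReal.ofReal h * ENNReal.ofReal h *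
          (((1 + K) ^ (n - 1) : ℝ≥0) * energy Ω φ) := by
          gcongr
          refine (lintegral_le_of_le_smul hle _).trans ?_
          gcongr
          exact lintegral_mono_set inter_subset_left
      _ = _ := by
          rw [ENNReal.ofReal]
          push_cast
          ring

end IsLocalGraph

/-! ### Global trace and Friedrichs inequalities for smooth functions -/

namespace IsBoundedLipschitzDomain

variable {Ω : Set (E n)}

lemma exists_isLocalGraph (hΩ : IsBoundedLipschitzDomain Ω) {x₀ : E n} (hx₀ : x₀ ∈ frontier Ω) :
    ∃ Φ γ K r, 0 < r ∧ IsLocalGraph Ω x₀ Φ γ K r := by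
  obtain ⟨Φ, γ, K, r, hγ, hr, h⟩ := hΩ.locally_graph x₀ hx₀
  exact ⟨Φ, γ, K, r, hr, hΩ.isOpen, hx₀, hγ, h⟩

lemma isFiniteMeasure_restrict (hΩ : IsBoundedLipschitzDomain Ω) :
    IsFiniteMeasure ((volume : Measure (E n)).restrict Ω) :=
  MeasureTheory.isFiniteMeasure_restrict.2 hΩ.isBounded.measure_lt_top.ne

lemma isCompact_frontier (hΩ : IsBoundedLipschitzDomain Ω) : IsCompact (frontier Ω) :=
  hΩ.isBounded.isCompact_closure.of_isClosed_subset isClosed_frontier frontier_subset_closure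

lemma isFiniteMeasure_surfaceMeasure (hΩ : IsBoundedLipschitzDomain Ω) :
    IsFiniteMeasure (surfaceMeasure Ω) := by
  have h : surfaceMeasure Ω (frontier Ω) < ⊤ := by
    refine hΩ.isCompact_frontier.measure_lt_top_of_nhdsWithin fun x hx => ?_
    obtain ⟨Φ, γ, K, r, hr, hg⟩ := hΩ.exists_isLocalGraph hx
    exact ⟨_, mem_nhdsWithin_of_mem_nhds (Metric.ball_mem_nhds x hr),
      hg.surfaceMeasure_ball_lt_top⟩
  refine ⟨?_⟩
  rw [surfaceMeasure, Measure.restrict_apply isClosed_frontier.measurableSet, inter_self] at h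
  rwa [surfaceMeasure, Measure.restrict_apply_univ]

lemma surfaceMeasure_pos (hΩ : IsBoundedLipschitzDomain Ω) {Γ : Set (E n)}
    (hΓ : IsOpenInBoundary Ω Γ) (hne : Γ.Nonempty) : 0 < surfaceMeasure Ω Γ := by
  obtain ⟨O, hO, rfl⟩ := hΓ
  obtain ⟨x, hxO, hx⟩ := hne
  obtain ⟨Φ, γ, K, r, hr, hg⟩ := hΩ.exists_isLocalGraph hx
  obtain ⟨δ, hδ, hδO⟩ := Metric.isOpen_iff.1 hO x hxO
  have h := hg.surfaceMeasure_ball_pos (lt_min hδ hr) (min_le_right δ r)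
  rw [surfaceMeasure, Measure.restrict_apply measurableSet_ball] at h
  rw [surfaceMeasure, Measure.restrict_apply
    (hO.measurableSet.inter isClosed_frontier.measurableSet), inter_assoc, inter_self]
  refine h.trans_le (measure_mono ?_)
  gcongr
  exact (Metric.ball_subset_ball (min_le_left _ _)).trans hδO

/-- Near a boundary point both the volume and the surface measure are related to any ball
inside the domain. -/
lemma exists_poincareRel (hΩ : IsBoundedLipschitzDomain Ω) {x₀ z : E n} (hx₀ : x₀ ∈ frontier Ω)
    {s : ℝ} (hs : 0 < s) (hz : Metric.ball z s ⊆ Ω) :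
    ∃ ρ > 0, PoincareRel Ω (volume.restrict (Ω ∩ Metric.ball x₀ ρ))
        (volume.restrict (Metric.ball z s)) ∧
      PoincareRel Ω ((surfaceMeasure Ω).restrict (Metric.ball x₀ ρ))
        (volume.restrict (Metric.ball z s)) := by
  obtain ⟨Φ, γ, K, r, hr, hg⟩ := hΩ.exists_isLocalGraph hx₀
  have := hΩ.isFiniteMeasure_restrict
  have hK : 0 ≤ (K : ℝ) := K.2
  have hfin : IsFiniteMeasure
      ((volume : Measure (E n)).restrict (Ω ∩ Metric.ball x₀ (r / (2 * (2 + K))))) :=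
    isFiniteMeasure_of_le _ (Measure.restrict_mono inter_subset_left le_rfl)
  -- With height `r / 2`, this radius satisfies both `(1 + K) * ρ < r / 2` and `r / 2 + ρ ≤ r`.
  set ρ := r / (2 * (2 + K)) with hρdef
  have hρ : 0 < ρ := by positivity
  have hρr : ρ * (2 * (2 + K)) = r := div_mul_cancel₀ _ (by positivity)
  have hh : (1 + K) * ρ < r / 2 := by nlinarith
  have hle : r / 2 + ρ ≤ r := by nlinarith [mul_nonneg hρ.le hK]
  have h1 := hg.poincareRel_inter_ball hρ hh hle
  have h2 := h1.trans (poincareRel_ball hΩ.isOpen hΩ.isConnected.isPreconnected hρ hs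
    (hg.ball_add_vertical_subset hρ hh hle) hz) (restrict_ball_ne_zero _ hρ)
  refine ⟨ρ / 2, by positivity, h2.mono_restrict ?_, ?_⟩
  · gcongr
    linarith
  -- Radius `ρ / 2` plus layer height `ρ / 2` reaches exactly the ball of radius `ρ` already treated
  -- by `h2`.
  · refine hg.poincareRel_surface (h := ρ / 2) (by linarith) (by positivity) ?_
    rwa [add_halves]

/-- Being related to the fixed ball passes to subsets and finite unions and holds near every point
of the compact closure, hence holds on all of it. -/
lemma poincareRel_volume (hΩ : IsBoundedLipschitzDomain Ω) {z : E n} {s : ℝ} (hs : 0 < s)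
    (hz : Metric.ball z s ⊆ Ω) :
    PoincareRel Ω (volume.restrict Ω) (volume.restrict (Metric.ball z s)) := by
  have key : PoincareRel Ω (volume.restrict (Ω ∩ closure Ω))
      (volume.restrict (Metric.ball z s)) := by
    refine hΩ.isBounded.isCompact_closure.induction_on
      (p := fun t => PoincareRel Ω (volume.restrict (Ω ∩ t)) (volume.restrict (Metric.ball z s)))
      ?_ (fun t u htu h => h.mono_restrict (inter_subset_inter_right _ htu))
      (fun t u ht hu => ?_) fun x hx => ?_
    · rw [inter_empty]
      exact PoincareRel.restrict_empty
    · rw [inter_union_distrib_left]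
      exact ht.union hu
    · by_cases hxΩ : x ∈ Ω
      · obtain ⟨R, hR, hRΩ⟩ := Metric.isOpen_iff.1 hΩ.isOpen x hxΩ
        exact ⟨_, mem_nhdsWithin_of_mem_nhds (Metric.ball_mem_nhds x hR),
          (poincareRel_ball hΩ.isOpen hΩ.isConnected.isPreconnected hR hs hRΩ hz).mono_restrict
            inter_subset_right⟩
      · have hxf : x ∈ frontier Ω := by
          rw [hΩ.isOpen.frontier_eq]
          exact ⟨hx, hxΩ⟩
        obtain ⟨ρ, hρ, h, -⟩ := hΩ.exists_poincareRel hxf hs hz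
        exact ⟨_, mem_nhdsWithin_of_mem_nhds (Metric.ball_mem_nhds x hρ), h⟩
  rwa [inter_eq_left.2 subset_closure] at key

lemma poincareRel_surfaceMeasure (hΩ : IsBoundedLipschitzDomain Ω) {z : E n} {s : ℝ} (hs : 0 < s)
    (hz : Metric.ball z s ⊆ Ω) :
    PoincareRel Ω (surfaceMeasure Ω) (volume.restrict (Metric.ball z s)) := by
  have key : PoincareRel Ω ((surfaceMeasure Ω).restrict (frontier Ω))
      (volume.restrict (Metric.ball z s)) := by
    refine hΩ.isCompact_frontier.induction_on
      (p := fun t => PoincareRel Ω ((surfaceMeasure Ω).restrict t)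
        (volume.restrict (Metric.ball z s)))
      PoincareRel.restrict_empty (fun t u htu h => h.mono_restrict htu)
      (fun t u ht hu => ht.union hu) fun x hx => ?_
    obtain ⟨ρ, hρ, -, h⟩ := hΩ.exists_poincareRel hx hs hz
    exact ⟨_, mem_nhdsWithin_of_mem_nhds (Metric.ball_mem_nhds x hρ), h⟩
  rwa [surfaceMeasure, Measure.restrict_restrict isClosed_frontier.measurableSet,
    inter_self] at key

end IsBoundedLipschitzDomain

/-- Turns oscillation bounds into norm bounds by averaging `|φ x|² ≤ 2|φ x - φ y|² + 2|φ y|²` over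
`y`. With `ν` an inner ball it yields the trace inequality, with `ν` a boundary piece the Friedrichs
inequality. -/
lemma PoincareRel.lintegral_sq_le {Ω : Set (E n)} {μ ν : Measure (E n)} [IsFiniteMeasure μ]
    [IsFiniteMeasure ν] (h : PoincareRel Ω μ ν) (hν : ν ≠ 0) :
    ∃ C : ℝ≥0, ∀ φ : E n → ℝ, ContDiff ℝ 1 φ →
      ∫⁻ x, ‖φ x‖ₑ ^ 2 ∂μ ≤ C * (energy Ω φ + ∫⁻ x, ‖φ x‖ₑ ^ 2 ∂ν) := by
  obtain ⟨C, hC⟩ := h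
  have hν0 : ν univ ≠ 0 := by simpa using hν
  have hνt : ν univ ≠ ⊤ := measure_ne_top _ _
  obtain ⟨c, hc⟩ : ∃ c : ℝ≥0, (c : ℝ≥0∞) = (ν univ)⁻¹ * (2 * C + 2 * μ univ) := by
    refine exists_coe_eq (ENNReal.mul_ne_top (ENNReal.inv_ne_top.2 hν0) ?_)
    finiteness
  refine ⟨c, fun φ hφ => ?_⟩
  have hm : Measurable fun x => ‖φ x‖ₑ ^ 2 := hφ.continuous.enorm.measurable.pow_const 2
  have hmx : ∀ x : E n, Measurable fun z => ‖φ x - φ z‖ₑ ^ 2 := fun x =>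
    measurable_enorm_sub_sq hφ measurable_const measurable_id
  have key : ν univ * ∫⁻ x, ‖φ x‖ₑ ^ 2 ∂μ ≤
      (2 * C + 2 * μ univ) * (energy Ω φ + ∫⁻ x, ‖φ x‖ₑ ^ 2 ∂ν) := by
    calc ν univ * ∫⁻ x, ‖φ x‖ₑ ^ 2 ∂μ = ∫⁻ x, ∫⁻ _y, ‖φ x‖ₑ ^ 2 ∂ν ∂μ := by
          rw [← lintegral_const_mul _ hm]
          simp [mul_comm]
      _ ≤ ∫⁻ x, ∫⁻ y, (2 * ‖φ x - φ y‖ₑ ^ 2 + 2 * ‖φ y‖ₑ ^ 2) ∂ν ∂μ := by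
          gcongr
          exact enorm_sq_le _ _
      _ = ∫⁻ x, (2 * ∫⁻ y, ‖φ x - φ y‖ₑ ^ 2 ∂ν + 2 * ∫⁻ y, ‖φ y‖ₑ ^ 2 ∂ν) ∂μ := by
          refine lintegral_congr fun x => ?_
          rw [lintegral_add_left ((hmx x).const_mul _), lintegral_const_mul _ (hmx x),
            lintegral_const_mul _ hm]
      _ = 2 * ∫⁻ x, ∫⁻ y, ‖φ x - φ y‖ₑ ^ 2 ∂ν ∂μ + 2 * (∫⁻ y, ‖φ y‖ₑ ^ 2 ∂ν) * μ univ := by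
          rw [lintegral_add_right _ measurable_const, lintegral_const,
            lintegral_const_mul _ (measurable_lintegral_enorm_sub_sq hφ _)]
      _ ≤ 2 * (C * energy Ω φ) + 2 * (∫⁻ y, ‖φ y‖ₑ ^ 2 ∂ν) * μ univ := by
          gcongr
          exact hC φ hφ
      -- The cross terms are added only so that the right side factors.
      _ ≤ 2 * (C * energy Ω φ) + 2 * (∫⁻ y, ‖φ y‖ₑ ^ 2 ∂ν) * μ univ +
          (2 * C * (∫⁻ y, ‖φ y‖ₑ ^ 2 ∂ν) + 2 * μ univ * energy Ω φ) := le_self_add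
      _ = _ := by ring
  rw [hc, mul_assoc]
  calc _ = (ν univ)⁻¹ * (ν univ * ∫⁻ x, ‖φ x‖ₑ ^ 2 ∂μ) := by
        rw [← mul_assoc, ENNReal.inv_mul_cancel hν0 hνt, one_mul]
    _ ≤ _ := by gcongr

namespace IsBoundedLipschitzDomain

variable {Ω : Set (E n)}

lemma exists_ball_subset (hΩ : IsBoundedLipschitzDomain Ω) :
    ∃ z : E n, ∃ s > 0, Metric.ball z s ⊆ Ω := by
  obtain ⟨z, hz⟩ := hΩ.isConnected.nonempty
  exact ⟨z, Metric.isOpen_iff.1 hΩ.isOpen z hz⟩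

/-- The trace inequality for `C¹` functions. -/
lemma lintegral_surface_sq_le (hΩ : IsBoundedLipschitzDomain Ω) :
    ∃ C : ℝ≥0, ∀ φ : E n → ℝ, ContDiff ℝ 1 φ →
      ∫⁻ x, ‖φ x‖ₑ ^ 2 ∂(surfaceMeasure Ω) ≤ C * (energy Ω φ + ∫⁻ x in Ω, ‖φ x‖ₑ ^ 2) := by
  obtain ⟨z, s, hs, hz⟩ := hΩ.exists_ball_subset
  have := hΩ.isFiniteMeasure_surfaceMeasure
  obtain ⟨C, hC⟩ := (hΩ.poincareRel_surfaceMeasure hs hz).lintegral_sq_le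
    (restrict_ball_ne_zero z hs)
  refine ⟨C, fun φ hφ => (hC φ hφ).trans ?_⟩
  gcongr

/-- The Friedrichs inequality for `C¹` functions. -/
lemma lintegral_sq_le_surface (hΩ : IsBoundedLipschitzDomain Ω) {Γ : Set (E n)}
    (hΓ : 0 < surfaceMeasure Ω Γ) :
    ∃ C : ℝ≥0, ∀ φ : E n → ℝ, ContDiff ℝ 1 φ →
      ∫⁻ x in Ω, ‖φ x‖ₑ ^ 2 ≤
        C * (energy Ω φ + ∫⁻ x in Γ, ‖φ x‖ₑ ^ 2 ∂(surfaceMeasure Ω)) := by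
  obtain ⟨z, s, hs, hz⟩ := hΩ.exists_ball_subset
  have := hΩ.isFiniteMeasure_surfaceMeasure
  have := hΩ.isFiniteMeasure_restrict
  have h := (hΩ.poincareRel_surfaceMeasure hs hz).mono_left (c := 1)
    (μ := (surfaceMeasure Ω).restrict Γ) (by rw [one_smul]; exact Measure.restrict_le_self)
  -- The volume of `Ω` is linked to `Γ` through the inner ball; positivity of the measure of `Γ`
  -- permits the final averaging.
  refine ((hΩ.poincareRel_volume hs hz).trans h.symm
    (restrict_ball_ne_zero z hs)).lintegral_sq_le ?_
  rw [Ne, Measure.restrict_eq_zero]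
  exact hΓ.ne'

end IsBoundedLipschitzDomain

/-! ### Traces as the closure of test data -/

lemma ofReal_norm_sq_eq_lintegral {α F : Type*} [MeasurableSpace α] [NormedAddCommGroup F]
    {μ : Measure α} (f : Lp F 2 μ) :
    ENNReal.ofReal (‖f‖ ^ 2) = ∫⁻ x, ‖f x‖ₑ ^ 2 ∂μ := by
  rw [Lp.norm_def, ENNReal.ofReal_pow ENNReal.toReal_nonneg,
    ENNReal.ofReal_toReal (Lp.eLpNorm_ne_top f),
    eLpNorm_eq_lintegral_rpow_enorm_toReal (by norm_num) (by norm_num), ← ENNReal.rpow_natCast,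
    ← ENNReal.rpow_mul]
  norm_num

lemma lintegral_eq_ofReal_norm_sq {α F : Type*} [MeasurableSpace α] [NormedAddCommGroup F]
    {μ : Measure α} {f : Lp F 2 μ} {φ : α → F} (h : f =ᵐ[μ] φ) :
    ∫⁻ x, ‖φ x‖ₑ ^ 2 ∂μ = ENNReal.ofReal (‖f‖ ^ 2) := by
  rw [ofReal_norm_sq_eq_lintegral]
  refine lintegral_congr_ae ?_
  filter_upwards [h] with x hx
  rw [hx]

lemma enorm_gradient (φ : E n → ℝ) (x : E n) : ‖gradient φ x‖ₑ = ‖fderiv ℝ φ x‖ₑ := by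
  rw [← ofReal_norm, ← ofReal_norm, gradient, LinearIsometryEquiv.norm_map]

lemma gradient_add {φ ψ : E n → ℝ} (hφ : Differentiable ℝ φ) (hψ : Differentiable ℝ ψ) (x : E n) :
    gradient (φ + ψ) x = gradient φ x + gradient ψ x := by
  rw [gradient, fderiv_add (hφ x) (hψ x), map_add]
  rfl

lemma gradient_const_smul {φ : E n → ℝ} (hφ : Differentiable ℝ φ) (c : ℝ) (x : E n) :
    gradient (c • φ) x = c • gradient φ x := by
  rw [gradient, fderiv_const_smul (hφ x), map_smulₛₗ]
  rfl

lemma continuous_gradient {φ : E n → ℝ} (hφ : ContDiff ℝ 1 φ) : Continuous (gradient φ) :=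
  (InnerProductSpace.toDual ℝ (E n)).symm.continuous.comp (hφ.continuous_fderiv (by simp))

lemma hasCompactSupport_gradient {φ : E n → ℝ} (hφ : HasCompactSupport φ) :
    HasCompactSupport (gradient φ) :=
  (hφ.fderiv ℝ).comp_left (g := (InnerProductSpace.toDual ℝ (E n)).symm) (map_zero _)

/-- The space of pairs `(u, G) ∈ L²(Ω) × L²(Ω)ⁿ`, in which `H¹(Ω)` lies. -/
abbrev PairSpace (Ω : Set (E n)) : Type :=
  WithLp 2 (Lp ℝ 2 (volume.restrict Ω) × Lp (E n) 2 (volume.restrict Ω))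

/-- The data `((φ, ∇φ), φ|_S)` of the test functions `φ`. -/
def smoothTraces (Ω : Set (E n)) : Submodule ℝ (PairSpace Ω × Lp ℝ 2 (surfaceMeasure Ω)) where
  carrier := {p | ∃ φ : E n → ℝ, ContDiff ℝ ∞ φ ∧ HasCompactSupport φ ∧
    p.1.fst =ᵐ[volume.restrict Ω] φ ∧ p.1.snd =ᵐ[volume.restrict Ω] gradient φ ∧
    p.2 =ᵐ[surfaceMeasure Ω] φ}
  zero_mem' := by
    refine ⟨0, contDiff_const, HasCompactSupport.zero, Lp.coeFn_zero _ _ _, ?_, Lp.coeFn_zero _ _ _⟩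
    filter_upwards [Lp.coeFn_zero (E n) 2 (volume.restrict Ω)] with x hx
    rw [Prod.fst_zero, WithLp.zero_snd, hx, gradient, fderiv_zero]
    simp
  add_mem' := by
    rintro p q ⟨φ, h1, h2, h3, h4, h5⟩ ⟨ψ, k1, k2, k3, k4, k5⟩
    refine ⟨φ + ψ, h1.add k1, h2.add k2, (Lp.coeFn_add _ _).trans (h3.add k3), ?_,
      (Lp.coeFn_add _ _).trans (h5.add k5)⟩
    filter_upwards [Lp.coeFn_add p.1.snd q.1.snd, h4, k4] with x hx h k
    rw [Prod.fst_add, WithLp.add_snd, hx, Pi.add_apply, h, k,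
      gradient_add (h1.differentiable (by simp)) (k1.differentiable (by simp))]
  smul_mem' := by
    rintro c p ⟨φ, h1, h2, h3, h4, h5⟩
    refine ⟨c • φ, h1.const_smul c, h2.smul_left (f := fun _ => c),
      (Lp.coeFn_smul _ _).trans (h3.const_smul c), ?_,
      (Lp.coeFn_smul _ _).trans (h5.const_smul c)⟩
    filter_upwards [Lp.coeFn_smul c p.1.snd, h4] with x hx h
    rw [Prod.smul_fst, WithLp.smul_snd, hx, Pi.smul_apply, h,
      gradient_const_smul (h1.differentiable (by simp))]

lemma tendsto_Lp_iff {α F ι : Type*} [MeasurableSpace α] [NormedAddCommGroup F] {μ : Measure α}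
    {l : Filter ι} {f : ι → Lp F 2 μ} {φ : ι → α → F} (h : ∀ i, f i =ᵐ[μ] φ i) (g : Lp F 2 μ) :
    Tendsto f l (𝓝 g) ↔ Tendsto (fun i => eLpNorm (fun x => φ i x - g x) 2 μ) l (𝓝 0) := by
  rw [Lp.tendsto_Lp_iff_tendsto_eLpNorm']
  refine tendsto_congr fun i => eLpNorm_congr_ae ?_
  filter_upwards [h i] with x hx
  rw [Pi.sub_apply, hx]

lemma tendsto_withLp_prod_iff {X Y ι : Type*} [TopologicalSpace X] [TopologicalSpace Y]
    {l : Filter ι} {f : ι → WithLp 2 (X × Y)} {g : WithLp 2 (X × Y)} :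
    Tendsto f l (𝓝 g) ↔
      Tendsto (fun i => (f i).fst) l (𝓝 g.fst) ∧ Tendsto (fun i => (f i).snd) l (𝓝 g.snd) := by
  refine ⟨fun h => ?_, fun h => ?_⟩
  · have := ((WithLp.prod_continuous_ofLp 2 X Y).tendsto g).comp h
    exact ⟨(continuous_fst.tendsto _).comp this, (continuous_snd.tendsto _).comp this⟩
  · exact ((WithLp.prod_continuous_toLp 2 X Y).tendsto (g.fst, g.snd)).comp (h.1.prodMk_nhds h.2)

/-- The graph of the trace operator is the closure of the traces of test functions. -/
lemma hasTrace_iff_mem_closure {Ω : Set (E n)} [IsFiniteMeasure (surfaceMeasure Ω)] {v : H1 Ω}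
    {g : Lp ℝ 2 (surfaceMeasure Ω)} :
    HasTrace v g ↔ ((v : PairSpace Ω), g) ∈ (smoothTraces Ω).topologicalClosure := by
  rw [← SetLike.mem_coe, Submodule.topologicalClosure_coe, mem_closure_iff_seq_limit]
  constructor
  · rintro ⟨φ, hφ, h1, h2, h3⟩
    have m1 : ∀ m, MemLp (φ m) 2 (volume.restrict Ω) := fun m =>
      (hφ m).1.continuous.memLp_of_hasCompactSupport (hφ m).2
    have m2 : ∀ m, MemLp (gradient (φ m)) 2 (volume.restrict Ω) := fun m =>
      (continuous_gradient ((hφ m).1.of_le (by simp))).memLp_of_hasCompactSupport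
        (hasCompactSupport_gradient (hφ m).2)
    have m3 : ∀ m, MemLp (φ m) 2 (surfaceMeasure Ω) := fun m =>
      (hφ m).1.continuous.memLp_of_hasCompactSupport (hφ m).2
    refine ⟨fun m => (WithLp.toLp 2 ((m1 m).toLp (φ m), (m2 m).toLp (gradient (φ m))),
      (m3 m).toLp (φ m)), fun m => ⟨φ m, (hφ m).1, (hφ m).2, (m1 m).coeFn_toLp,
      (m2 m).coeFn_toLp, (m3 m).coeFn_toLp⟩, ?_⟩
    refine Tendsto.prodMk_nhds (tendsto_withLp_prod_iff.2 ⟨?_, ?_⟩) ?_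
    · exact (tendsto_Lp_iff (fun m => (m1 m).coeFn_toLp) _).2 h1
    · exact (tendsto_Lp_iff (fun m => (m2 m).coeFn_toLp) _).2 h2
    · exact (tendsto_Lp_iff (fun m => (m3 m).coeFn_toLp) _).2 h3
  · rintro ⟨p, hp, hlim⟩
    choose φ hφ using hp
    have h1 := (continuous_fst.tendsto _).comp hlim
    have h2 := (continuous_snd.tendsto _).comp hlim
    rw [tendsto_withLp_prod_iff] at h1
    exact ⟨φ, fun m => ⟨(hφ m).1, (hφ m).2.1⟩,
      (tendsto_Lp_iff (fun m => (hφ m).2.2.1) _).1 h1.1,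
      (tendsto_Lp_iff (fun m => (hφ m).2.2.2.1) _).1 h1.2,
      (tendsto_Lp_iff (fun m => (hφ m).2.2.2.2) _).1 h2⟩

/-- Restriction of functions on the boundary to `Γ`. -/
abbrev restrictTo (Ω Γ : Set (E n)) :
    Lp ℝ 2 (surfaceMeasure Ω) →L[ℝ] Lp ℝ 2 ((surfaceMeasure Ω).restrict Γ) :=
  LpToLpRestrictCLM (E n) ℝ ℝ (surfaceMeasure Ω) 2 Γ

lemma restrictTo_eq_iff {Ω Γ : Set (E n)} {g : Lp ℝ 2 (surfaceMeasure Ω)}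
    {f : Lp ℝ 2 ((surfaceMeasure Ω).restrict Γ)} :
    restrictTo Ω Γ g = f ↔ g =ᵐ[(surfaceMeasure Ω).restrict Γ] f := by
  have h := LpToLpRestrictCLM_coeFn ℝ (p := 2) Γ g
  exact ⟨fun e => e ▸ h.symm, fun e => Lp.ext (h.trans e)⟩

lemma restrictTo_eq_zero_iff {Ω Γ : Set (E n)} {g : Lp ℝ 2 (surfaceMeasure Ω)} :
    restrictTo Ω Γ g = 0 ↔ g =ᵐ[(surfaceMeasure Ω).restrict Γ] 0 :=
  restrictTo_eq_iff.trans
    ⟨fun h => h.trans (Lp.coeFn_zero _ _ _), fun h => h.trans (Lp.coeFn_zero _ _ _).symm⟩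

namespace IsBoundedLipschitzDomain

variable {Ω : Set (E n)}

/-- The trace inequality. -/
lemma norm_trace_sq_le (hΩ : IsBoundedLipschitzDomain Ω) :
    ∃ C : ℝ≥0, ∀ p ∈ (smoothTraces Ω).topologicalClosure, ‖p.2‖ ^ 2 ≤ C * ‖p.1‖ ^ 2 := by
  obtain ⟨C, hC⟩ := hΩ.lintegral_surface_sq_le
  refine ⟨C, fun p hp => ?_⟩
  -- The inequality is a closed condition on the pair, so it needs checking only on the data of test
  -- functions.
  have hcl : IsClosed {p : PairSpace Ω × Lp ℝ 2 (surfaceMeasure Ω) | ‖p.2‖ ^ 2 ≤ C * ‖p.1‖ ^ 2} :=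
    isClosed_le (by fun_prop) (by fun_prop)
  refine closure_minimal ?_ hcl hp
  rintro q ⟨φ, h1, h2, h3, h4, h5⟩
  have h := hC φ (h1.of_le (by simp))
  simp only [energy, ← enorm_gradient] at h
  rw [lintegral_eq_ofReal_norm_sq h3, lintegral_eq_ofReal_norm_sq h4,
    lintegral_eq_ofReal_norm_sq h5, ← ENNReal.ofReal_add (by positivity) (by positivity),
    ← ENNReal.ofReal_coe_nnreal, ← ENNReal.ofReal_mul (by positivity),
    ENNReal.ofReal_le_ofReal_iff (by positivity)] at h
  rw [mem_ofPred_eq, WithLp.prod_norm_sq_eq_of_L2]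
  linarith

/-- The Friedrichs inequality. -/
lemma norm_fst_sq_le (hΩ : IsBoundedLipschitzDomain Ω) {Γ : Set (E n)}
    (hΓ : 0 < surfaceMeasure Ω Γ) :
    ∃ C : ℝ≥0, ∀ p ∈ (smoothTraces Ω).topologicalClosure,
      ‖p.1.fst‖ ^ 2 ≤ C * (‖p.1.snd‖ ^ 2 + ‖restrictTo Ω Γ p.2‖ ^ 2) := by
  obtain ⟨C, hC⟩ := hΩ.lintegral_sq_le_surface hΓ
  refine ⟨C, fun p hp => ?_⟩
  have hcl : IsClosed {p : PairSpace Ω × Lp ℝ 2 (surfaceMeasure Ω) |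
      ‖p.1.fst‖ ^ 2 ≤ C * (‖p.1.snd‖ ^ 2 + ‖restrictTo Ω Γ p.2‖ ^ 2)} := by
    have c1 : Continuous fun p : PairSpace Ω × Lp ℝ 2 (surfaceMeasure Ω) => p.1.fst :=
      (WithLp.fstL 2 ℝ _ _).continuous.comp continuous_fst
    have c2 : Continuous fun p : PairSpace Ω × Lp ℝ 2 (surfaceMeasure Ω) => p.1.snd :=
      (WithLp.sndL 2 ℝ _ _).continuous.comp continuous_fst
    have c3 : Continuous fun p : PairSpace Ω × Lp ℝ 2 (surfaceMeasure Ω) => restrictTo Ω Γ p.2 :=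
      (restrictTo Ω Γ).continuous.comp continuous_snd
    exact isClosed_le (c1.norm.pow 2) (continuous_const.mul ((c2.norm.pow 2).add (c3.norm.pow 2)))
  refine closure_minimal ?_ hcl hp
  rintro q ⟨φ, h1, h2, h3, h4, h5⟩
  have h := hC φ (h1.of_le (by simp))
  have h6 : restrictTo Ω Γ q.2 =ᵐ[(surfaceMeasure Ω).restrict Γ] φ :=
    (LpToLpRestrictCLM_coeFn ℝ (p := 2) Γ q.2).trans (ae_restrict_of_ae h5)
  simp only [energy, ← enorm_gradient] at h
  rw [lintegral_eq_ofReal_norm_sq h3, lintegral_eq_ofReal_norm_sq h4,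
    lintegral_eq_ofReal_norm_sq h6, ← ENNReal.ofReal_add (by positivity) (by positivity),
    ← ENNReal.ofReal_coe_nnreal, ← ENNReal.ofReal_mul (by positivity),
    ENNReal.ofReal_le_ofReal_iff (by positivity)] at h
  exact h

end IsBoundedLipschitzDomain

/-! ### Closedness of the spaces with vanishing trace -/

/-- The trace pairs whose trace vanishes on `Γ`. -/
def vanishingTraces (Ω Γ : Set (E n)) : Submodule ℝ (PairSpace Ω × Lp ℝ 2 (surfaceMeasure Ω)) :=
  (smoothTraces Ω).topologicalClosure ⊓
    LinearMap.ker ((restrictTo Ω Γ).comp (ContinuousLinearMap.snd ℝ (PairSpace Ω) _)).toLinearMap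

lemma isClosed_vanishingTraces (Ω Γ : Set (E n)) :
    IsClosed (vanishingTraces Ω Γ : Set (PairSpace Ω × Lp ℝ 2 (surfaceMeasure Ω))) :=
  (smoothTraces Ω).isClosed_topologicalClosure.inter
    ((restrictTo Ω Γ).comp (ContinuousLinearMap.snd ℝ (PairSpace Ω) _)).isClosed_ker

/-- The subspace of the elements of `H¹(Ω)` with vanishing trace on `Γ`. -/
def vanishingSpace (Ω Γ : Set (E n)) : Submodule ℝ (PairSpace Ω) :=
  H1 Ω ⊓ (vanishingTraces Ω Γ).map (LinearMap.fst ℝ _ _)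

/-- Projections of closed subspaces need not be closed. Here the discarded trace component is
bounded by the retained one through the trace inequality, so the projection is antilipschitz on a
complete space. -/
lemma isClosed_map_vanishingTraces {Ω : Set (E n)} (hΩ : IsBoundedLipschitzDomain Ω)
    (Γ : Set (E n)) :
    IsClosed ((vanishingTraces Ω Γ).map (LinearMap.fst ℝ _ _) : Set (PairSpace Ω)) := by
  obtain ⟨C, hC⟩ := hΩ.norm_trace_sq_le
  have : CompleteSpace (vanishingTraces Ω Γ) :=
    (isClosed_vanishingTraces Ω Γ).completeSpace_coe
  let f : vanishingTraces Ω Γ →L[ℝ] PairSpace Ω :=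
    (ContinuousLinearMap.fst ℝ _ _).comp (vanishingTraces Ω Γ).subtypeL
  -- The constant `1 + C` avoids a square root, since `C ≤ (1 + C)²`.
  have hf : AntilipschitzWith (1 + C) f := by
    refine AddMonoidHomClass.antilipschitz_of_bound f fun p => ?_
    have h := hC p.1 p.2.1
    change max ‖p.1.1‖ ‖p.1.2‖ ≤ _ * ‖p.1.1‖
    have hC0 : 0 ≤ (C : ℝ) := C.2
    push_cast
    refine max_le (by nlinarith [norm_nonneg p.1.1]) ?_
    refine abs_le_of_sq_le_sq' ?_ (by positivity) |>.2
    refine h.trans ?_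
    rw [mul_pow]
    gcongr
    nlinarith
  have he : ((vanishingTraces Ω Γ).map (LinearMap.fst ℝ _ _) : Set (PairSpace Ω)) = range f :=
    Set.ext fun x => ⟨fun ⟨p, hp, h⟩ => ⟨⟨p, hp⟩, h⟩, fun ⟨p, h⟩ => ⟨p.1, p.2, h⟩⟩
  rw [he]
  exact hf.isClosed_range f.uniformContinuous

/-- For a fixed test function and coordinate, both sides of the weak gradient identity are, up to
sign, `L²` inner products with fixed elements, hence continuous in the pair. -/
lemma isClosed_H1 (Ω : Set (E n)) : IsClosed (H1 Ω : Set (PairSpace Ω)) := by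
  have hset : (H1 Ω : Set (PairSpace Ω)) = ⋂ (φ : E n → ℝ) (_ : ContDiff ℝ ∞ φ)
      (_ : HasCompactSupport φ) (_ : tsupport φ ⊆ Ω) (i : Fin n),
      {p : PairSpace Ω | ∫ x in Ω, p.fst x * fderiv ℝ φ x (EuclideanSpace.single i 1) =
        - ∫ x in Ω, p.snd x i * φ x} := by
    ext p
    simp only [mem_iInter]
    rfl
  rw [hset]
  refine isClosed_iInter fun φ => isClosed_iInter fun h1 => isClosed_iInter fun h2 =>
    isClosed_iInter fun _ => isClosed_iInter fun i => ?_
  have hd := test_deriv h1 h2 (EuclideanSpace.single i 1)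
  have m1 : MemLp (fun x => fderiv ℝ φ x (EuclideanSpace.single i 1)) 2 (volume.restrict Ω) :=
    hd.1.memLp_of_hasCompactSupport hd.2
  have m2 : MemLp (fun x => φ x • (EuclideanSpace.single i 1 : E n)) 2 (volume.restrict Ω) :=
    (h1.continuous.smul continuous_const).memLp_of_hasCompactSupport h2.smul_right
  have e1 : ∀ p : PairSpace Ω,
      ∫ x in Ω, p.fst x * fderiv ℝ φ x (EuclideanSpace.single i 1) = inner ℝ (m1.toLp _) p.fst := by
    intro p
    rw [L2.inner_def]
    refine integral_congr_ae ?_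
    filter_upwards [m1.coeFn_toLp] with x hx
    rw [hx]
    rfl
  have e2 : ∀ p : PairSpace Ω, ∫ x in Ω, p.snd x i * φ x = inner ℝ (m2.toLp _) p.snd := by
    intro p
    rw [L2.inner_def]
    refine integral_congr_ae ?_
    filter_upwards [m2.coeFn_toLp] with x hx
    rw [hx, real_inner_smul_left, EuclideanSpace.inner_single_left]
    simp [mul_comm]
  simp only [e1, e2]
  refine isClosed_eq ?_ ?_
  · exact continuous_const.inner (WithLp.fstL 2 ℝ _ _).continuous
  · exact (continuous_const.inner (WithLp.sndL 2 ℝ _ _).continuous).neg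

lemma isClosed_vanishingSpace {Ω : Set (E n)} (hΩ : IsBoundedLipschitzDomain Ω) (Γ : Set (E n)) :
    IsClosed (vanishingSpace Ω Γ : Set (PairSpace Ω)) :=
  (isClosed_H1 Ω).inter (isClosed_map_vanishingTraces hΩ Γ)

lemma mem_Vtilde_iff {Ω : Set (E n)} [IsFiniteMeasure (surfaceMeasure Ω)] {k : ℕ}
    {Γ Γ₀ : Fin k → Set (E n)} {v : H1 Ω} :
    v ∈ Vtilde Ω Γ Γ₀ ↔ (v : PairSpace Ω) ∈ vanishingSpace Ω (⋃ i, (Γ i ∪ Γ₀ i)) := by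
  constructor
  · rintro ⟨g, hg, h0⟩
    exact ⟨v.2, (v, g), ⟨hasTrace_iff_mem_closure.1 hg, restrictTo_eq_zero_iff.2 h0⟩, rfl⟩
  · rintro ⟨_, ⟨p, g⟩, ⟨hg, h0⟩, hp⟩
    obtain rfl : p = v := hp
    exact ⟨g, hasTrace_iff_mem_closure.2 hg, restrictTo_eq_zero_iff.1 h0⟩

/-! ### The energy form and the variational problem -/

section Form

variable {Ω : Set (E n)} {ε : E n → ℝ} {e₁ e₂ : ℝ}

/-- `M` is multiplication by `ε`, bounded on `L²` by `e₂`. Linearity and continuity of the form are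
all read off from it. -/
lemma exists_form_eq_inner (hε : MemLp ε ⊤ (volume.restrict Ω)) (he₁ : 0 < e₁)
    (hbd : ∀ᵐ x ∂(volume.restrict Ω), e₁ ≤ ε x ∧ ε x ≤ e₂) :
    ∃ M : Lp (E n) 2 (volume.restrict Ω) →L[ℝ] Lp (E n) 2 (volume.restrict Ω),
      ∀ v h : H1 Ω, form ε v h = inner ℝ (M (grad v)) (grad h) := by
  have hmem : ∀ G : Lp (E n) 2 (volume.restrict Ω),
      MemLp (fun x => ε x • G x) 2 (volume.restrict Ω) := fun G => (Lp.memLp G).smul hε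
  let M₀ : Lp (E n) 2 (volume.restrict Ω) →ₗ[ℝ] Lp (E n) 2 (volume.restrict Ω) :=
    { toFun := fun G => (hmem G).toLp _
      map_add' := by
        intro G H
        refine Lp.ext ?_
        filter_upwards [(hmem (G + H)).coeFn_toLp, (hmem G).coeFn_toLp, (hmem H).coeFn_toLp,
          Lp.coeFn_add G H, Lp.coeFn_add ((hmem G).toLp _) ((hmem H).toLp _)] with x h1 h2 h3 h4 h5
        rw [h1, h5, h4, Pi.add_apply, Pi.add_apply, h2, h3, smul_add]
      map_smul' := by
        intro c G
        refine Lp.ext ?_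
        filter_upwards [(hmem (c • G)).coeFn_toLp, (hmem G).coeFn_toLp, Lp.coeFn_smul c G,
          Lp.coeFn_smul c ((hmem G).toLp _)] with x h1 h2 h3 h4
        rw [h1, RingHom.id_apply, h4, h3, Pi.smul_apply, Pi.smul_apply, h2, smul_comm] }
  have hM₀ : ∀ G, M₀ G =ᵐ[volume.restrict Ω] fun x => ε x • G x := fun G => (hmem G).coeFn_toLp
  refine ⟨M₀.mkContinuous e₂ fun G => Lp.norm_le_mul_norm_of_ae_le_mul ?_, fun v h => ?_⟩
  · filter_upwards [hM₀ G, hbd] with x hx hb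
    rw [hx, norm_smul, Real.norm_of_nonneg (he₁.le.trans hb.1)]
    exact mul_le_mul_of_nonneg_right hb.2 (norm_nonneg _)
  · rw [L2.inner_def, form]
    refine integral_congr_ae ?_
    filter_upwards [hM₀ (grad v)] with x hx
    rw [LinearMap.mkContinuous_apply, hx, real_inner_smul_left]

lemma le_form_self (hε : MemLp ε ⊤ (volume.restrict Ω)) (he₁ : 0 < e₁)
    (hbd : ∀ᵐ x ∂(volume.restrict Ω), e₁ ≤ ε x ∧ ε x ≤ e₂) (v : H1 Ω) :
    e₁ * ‖grad v‖ ^ 2 ≤ form ε v v := by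
  have hG := L2.integrable_inner (𝕜 := ℝ) (grad v) (grad v)
  rw [← real_inner_self_eq_norm_sq, L2.inner_def, ← integral_const_mul]
  refine integral_mono_ae (hG.const_mul e₁) (hG.bdd_mul hε.aestronglyMeasurable (c := e₂) ?_) ?_
  · filter_upwards [hbd] with x hx
    rw [Real.norm_of_nonneg (he₁.le.trans hx.1)]
    exact hx.2
  · filter_upwards [hbd] with x hx
    exact mul_le_mul_of_nonneg_right hx.1 real_inner_self_nonneg

end Form

lemma norm_sq_eq {Ω : Set (E n)} (v : H1 Ω) : ‖v‖ ^ 2 = ‖func v‖ ^ 2 + ‖grad v‖ ^ 2 :=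
  WithLp.prod_norm_sq_eq_of_L2 (v : PairSpace Ω)

/-- The Lax–Milgram theorem for the form `(v, w) ↦ ⟪M (S v), S w⟫` on a closed subspace. -/
lemma exists_inner_eq_of_coercive {H F : Type*} [NormedAddCommGroup H] [InnerProductSpace ℝ H]
    [CompleteSpace H] [NormedAddCommGroup F] [InnerProductSpace ℝ F] {V : Submodule ℝ H}
    (hV : IsClosed (V : Set H)) (S : H →L[ℝ] F) (M : F →L[ℝ] F) {c : ℝ} (hc : 0 < c)
    (hcoer : ∀ v ∈ V, c * ‖v‖ ^ 2 ≤ inner ℝ (M (S v)) (S v)) (g : F) :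
    ∃ u ∈ V, ∀ w ∈ V, inner ℝ (M (S u)) (S w) = - inner ℝ g (S w) := by
  have : CompleteSpace V := hV.completeSpace_coe
  let T : V →L[ℝ] F := S.comp V.subtypeL
  let B : V →L[ℝ] V →L[ℝ] ℝ := (innerSL ℝ).bilinearComp (M.comp T) T
  have hB : IsCoercive B := by
    refine ⟨c, hc, fun v => ?_⟩
    rw [mul_assoc, ← pow_two]
    exact hcoer v.1 v.2
  let l : V →L[ℝ] ℝ := -((innerSL ℝ g).comp T)
  let u : V := hB.continuousLinearEquivOfBilin.symm ((InnerProductSpace.toDual ℝ V).symm l)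
  refine ⟨u.1, u.2, fun w hw => ?_⟩
  change B u ⟨w, hw⟩ = l ⟨w, hw⟩
  rw [← hB.continuousLinearEquivOfBilin_apply, ContinuousLinearEquiv.apply_symm_apply,
    InnerProductSpace.toDual_symm_apply]

section Variational

variable {Ω : Set (E n)} {k : ℕ} {Γ Γ₀ : Fin k → Set (E n)} {ε : E n → ℝ} {e₁ e₂ : ℝ}

lemma surfaceMeasure_iUnion_pos (hΩ : IsBoundedLipschitzDomain Ω)
    (hΓ : ∀ i, IsOpenInBoundary Ω (Γ i)) (hΓ₀ : ∀ i, IsOpenInBoundary Ω (Γ₀ i))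
    (hne : (⋃ i, (Γ i ∪ Γ₀ i)).Nonempty) : 0 < surfaceMeasure Ω (⋃ i, (Γ i ∪ Γ₀ i)) := by
  obtain ⟨x, hx⟩ := hne
  obtain ⟨i, hi⟩ := mem_iUnion.1 hx
  have hsub := subset_iUnion (fun i => Γ i ∪ Γ₀ i) i
  rcases hi with hi | hi
  · exact (hΩ.surfaceMeasure_pos (hΓ i) ⟨x, hi⟩).trans_le
      (measure_mono (subset_union_left.trans hsub))
  · exact (hΩ.surfaceMeasure_pos (hΓ₀ i) ⟨x, hi⟩).trans_le
      (measure_mono (subset_union_right.trans hsub))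

/-- The form is coercive on `Ṽ`. -/
lemma exists_coercive (hΩ : IsBoundedLipschitzDomain Ω)
    (hpos : 0 < surfaceMeasure Ω (⋃ i, (Γ i ∪ Γ₀ i)))
    (hε : MemLp ε ⊤ (volume.restrict Ω)) (he₁ : 0 < e₁)
    (hbd : ∀ᵐ x ∂(volume.restrict Ω), e₁ ≤ ε x ∧ ε x ≤ e₂) :
    ∃ c > 0, ∀ v ∈ Vtilde Ω Γ Γ₀, c * ‖v‖ ^ 2 ≤ form ε v v := by
  have := hΩ.isFiniteMeasure_surfaceMeasure
  obtain ⟨C, hC⟩ := hΩ.norm_fst_sq_le hpos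
  have hC0 : 0 ≤ (C : ℝ) := C.2
  -- On `Ṽ` the boundary term in the Friedrichs inequality is zero, so `‖v‖² ≤ (1 + C) ‖grad v‖²`.
  refine ⟨e₁ / (1 + C), by positivity, fun v hv => ?_⟩
  refine le_trans ?_ (le_form_self hε he₁ hbd v)
  obtain ⟨g, hg, h0⟩ := hv
  have h := hC ((v : PairSpace Ω), g) (hasTrace_iff_mem_closure.1 hg)
  dsimp only at h
  rw [restrictTo_eq_zero_iff.2 h0, norm_zero] at h
  change ‖func v‖ ^ 2 ≤ C * (‖grad v‖ ^ 2 + 0 ^ 2) at h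
  rw [norm_sq_eq, div_mul_eq_mul_div, div_le_iff₀ (by positivity), mul_assoc]
  gcongr
  linarith

lemma Vtilde_sub_mem [IsFiniteMeasure (surfaceMeasure Ω)] {v w : H1 Ω} (hv : v ∈ Vtilde Ω Γ Γ₀)
    (hw : w ∈ Vtilde Ω Γ Γ₀) : v - w ∈ Vtilde Ω Γ Γ₀ := by
  rw [mem_Vtilde_iff] at *
  exact sub_mem hv hw

lemma form_add_left (hε : MemLp ε ⊤ (volume.restrict Ω)) (he₁ : 0 < e₁)
    (hbd : ∀ᵐ x ∂(volume.restrict Ω), e₁ ≤ ε x ∧ ε x ≤ e₂) (u v h : H1 Ω) :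
    form ε (u + v) h = form ε u h + form ε v h := by
  obtain ⟨M, hM⟩ := exists_form_eq_inner hε he₁ hbd
  have : grad (u + v) = grad u + grad v := rfl
  rw [hM, hM, hM, this, map_add, inner_add_left]

lemma form_sub_left (hε : MemLp ε ⊤ (volume.restrict Ω)) (he₁ : 0 < e₁)
    (hbd : ∀ᵐ x ∂(volume.restrict Ω), e₁ ≤ ε x ∧ ε x ≤ e₂) (u v h : H1 Ω) :
    form ε (u - v) h = form ε u h - form ε v h := by
  rw [eq_sub_iff_add_eq, ← form_add_left hε he₁ hbd, sub_add_cancel]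

/-- Two elements whose difference lies in `Ṽ` and has equal action on `Ṽ` coincide. -/
lemma eq_of_form_eq (hΩ : IsBoundedLipschitzDomain Ω)
    (hpos : 0 < surfaceMeasure Ω (⋃ i, (Γ i ∪ Γ₀ i)))
    (hε : MemLp ε ⊤ (volume.restrict Ω)) (he₁ : 0 < e₁)
    (hbd : ∀ᵐ x ∂(volume.restrict Ω), e₁ ≤ ε x ∧ ε x ≤ e₂) {u v : H1 Ω}
    (huv : u - v ∈ Vtilde Ω Γ Γ₀) (h : ∀ w ∈ Vtilde Ω Γ Γ₀, form ε u w = form ε v w) :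
    u = v := by
  obtain ⟨c, hc, hcoer⟩ := exists_coercive hΩ hpos hε he₁ hbd
  -- The difference `u - v` is itself an admissible test function.
  have h1 := hcoer _ huv
  rw [form_sub_left hε he₁ hbd, h _ huv, sub_self] at h1
  have h2 : ‖u - v‖ ^ 2 ≤ 0 := by
    by_contra! hlt
    exact absurd h1 (not_le.2 (mul_pos hc hlt))
  exact sub_eq_zero.1 (norm_eq_zero.1 (pow_eq_zero_iff two_ne_zero |>.1
    (le_antisymm h2 (by positivity))))

/-- Solvability of the variational problem, by the Lax–Milgram theorem. -/
lemma exists_solvesVariational (hΩ : IsBoundedLipschitzDomain Ω)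
    (hpos : 0 < surfaceMeasure Ω (⋃ i, (Γ i ∪ Γ₀ i)))
    (hε : MemLp ε ⊤ (volume.restrict Ω)) (he₁ : 0 < e₁)
    (hbd : ∀ᵐ x ∂(volume.restrict Ω), e₁ ≤ ε x ∧ ε x ≤ e₂) (θ' : H1 Ω) :
    ∃ u : H1 Ω, SolvesVariational Γ Γ₀ ε θ' u := by
  have := hΩ.isFiniteMeasure_surfaceMeasure
  obtain ⟨c, hc, hcoer⟩ := exists_coercive hΩ hpos hε he₁ hbd
  obtain ⟨M, hM⟩ := exists_form_eq_inner hε he₁ hbd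
  obtain ⟨u, hu, hu'⟩ := exists_inner_eq_of_coercive
    (isClosed_vanishingSpace hΩ (⋃ i, (Γ i ∪ Γ₀ i))) (WithLp.sndL 2 ℝ _ _) M hc
    (fun v hv => (hcoer ⟨v, hv.1⟩ (mem_Vtilde_iff.2 hv)).trans_eq (hM ⟨v, hv.1⟩ ⟨v, hv.1⟩))
    (M (grad θ'))
  refine ⟨⟨u, hu.1⟩, mem_Vtilde_iff.2 hu, fun h hh => ?_⟩
  rw [hM, hM]
  exact hu' h (mem_Vtilde_iff.1 hh)

end Variational

/-! ### Boundary data and their extension -/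

section Data

variable {Ω : Set (E n)} {k : ℕ} {Γ Γ₀ : Fin k → Set (E n)}
  {U : ∀ i, Lp ℝ 2 ((surfaceMeasure Ω).restrict (Γ i))}

lemma HasTrace.add [IsFiniteMeasure (surfaceMeasure Ω)] {v w : H1 Ω}
    {g h : Lp ℝ 2 (surfaceMeasure Ω)} (hv : HasTrace v g) (hw : HasTrace w h) :
    HasTrace (v + w) (g + h) :=
  hasTrace_iff_mem_closure.2
    (add_mem (hasTrace_iff_mem_closure.1 hv) (hasTrace_iff_mem_closure.1 hw))

lemma HasTrace.sub [IsFiniteMeasure (surfaceMeasure Ω)] {v w : H1 Ω}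
    {g h : Lp ℝ 2 (surfaceMeasure Ω)} (hv : HasTrace v g) (hw : HasTrace w h) :
    HasTrace (v - w) (g - h) :=
  hasTrace_iff_mem_closure.2
    (sub_mem (hasTrace_iff_mem_closure.1 hv) (hasTrace_iff_mem_closure.1 hw))

lemma HasTrace.sum [IsFiniteMeasure (surfaceMeasure Ω)] {ι : Type*} (s : Finset ι) {v : ι → H1 Ω}
    {g : ι → Lp ℝ 2 (surfaceMeasure Ω)} (h : ∀ i, HasTrace (v i) (g i)) :
    HasTrace (∑ i ∈ s, v i) (∑ i ∈ s, g i) := by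
  classical
  induction s using Finset.induction_on with
  | empty => exact hasTrace_iff_mem_closure.2 (zero_mem (smoothTraces Ω).topologicalClosure)
  | insert i s hi ih =>
    rw [Finset.sum_insert hi, Finset.sum_insert hi]
    exact (h i).add ih

lemma ae_zero_iUnion_iff {g : E n → ℝ} :
    g =ᵐ[(surfaceMeasure Ω).restrict (⋃ i, (Γ i ∪ Γ₀ i))] 0 ↔
      ∀ i, g =ᵐ[(surfaceMeasure Ω).restrict (Γ i)] 0 ∧
        g =ᵐ[(surfaceMeasure Ω).restrict (Γ₀ i)] 0 := by
  simp only [EventuallyEq, ae_restrict_iUnion_iff, ae_restrict_union_iff]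

lemma DirichletData.sub_mem_Vtilde [IsFiniteMeasure (surfaceMeasure Ω)] {v w : H1 Ω}
    (hv : DirichletData Γ Γ₀ U v) (hw : DirichletData Γ Γ₀ U w) : v - w ∈ Vtilde Ω Γ Γ₀ := by
  obtain ⟨g, hg, hg1, hg2⟩ := hv
  obtain ⟨h, hh, hh1, hh2⟩ := hw
  refine ⟨g - h, hg.sub hh, ae_zero_iUnion_iff.2 fun i => ⟨?_, ?_⟩⟩
  · rw [← restrictTo_eq_zero_iff, map_sub, restrictTo_eq_iff.2 (hg1 i),
      restrictTo_eq_iff.2 (hh1 i), sub_self]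
  · rw [← restrictTo_eq_zero_iff, map_sub, restrictTo_eq_zero_iff.2 (hg2 i),
      restrictTo_eq_zero_iff.2 (hh2 i), sub_self]

lemma DirichletData.add_Vtilde [IsFiniteMeasure (surfaceMeasure Ω)] {v w : H1 Ω}
    (hv : DirichletData Γ Γ₀ U v) (hw : w ∈ Vtilde Ω Γ Γ₀) : DirichletData Γ Γ₀ U (v + w) := by
  obtain ⟨g, hg, hg1, hg2⟩ := hv
  obtain ⟨h, hh, h0⟩ := hw
  have h0 := ae_zero_iUnion_iff.1 h0
  refine ⟨g + h, hg.add hh, fun i => ?_, fun i => ?_⟩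
  · rw [← restrictTo_eq_iff, map_add, restrictTo_eq_iff.2 (hg1 i),
      restrictTo_eq_zero_iff.2 (h0 i).1, add_zero]
  · rw [← restrictTo_eq_zero_iff, map_add, restrictTo_eq_zero_iff.2 (hg2 i),
      restrictTo_eq_zero_iff.2 (h0 i).2, add_zero]

/-- A relatively open set disjoint from `B` also misses `closure B`. This carries the vanishing of a
trace off `closure (Γ j)` over to every other electrode. -/
lemma IsOpenInBoundary.subset_diff_closure {A B : Set (E n)} (hA : IsOpenInBoundary Ω A)
    (hB : IsOpenInBoundary Ω B) (h : Disjoint A B) : A ⊆ frontier Ω \ closure B := by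
  obtain ⟨O, hO, rfl⟩ := hA
  obtain ⟨O', -, rfl⟩ := hB
  rintro x ⟨hxO, hx⟩
  refine ⟨hx, fun hcl => ?_⟩
  obtain ⟨y, hyO, hy⟩ := mem_closure_iff.1 hcl O hO hxO
  exact Set.disjoint_left.1 h ⟨hyO, hy.2⟩ hy

/-- Boundary data in the spaces `H₀₀^{1/2}(Γᵢ)` extend to `H¹(Ω)`. -/
lemma exists_dirichletData [IsFiniteMeasure (surfaceMeasure Ω)]
    (hΓ : ∀ i, IsOpenInBoundary Ω (Γ i)) (hΓ₀ : ∀ i, IsOpenInBoundary Ω (Γ₀ i))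
    (hdisj : ∀ i j, i ≠ j → Disjoint (Γ i) (Γ j)) (hdisj₀ : ∀ i j, Disjoint (Γ i) (Γ₀ j))
    (hU : ∀ i, U i ∈ H00half Ω (Γ i)) : ∃ θ' : H1 Ω, DirichletData Γ Γ₀ U θ' := by
  choose v g hg hgU hg0 using hU
  have hzero : ∀ {A : Set (E n)} (j : Fin k), IsOpenInBoundary Ω A → Disjoint A (Γ j) →
      restrictTo Ω A (g j) = 0 := fun {A} j hA hd =>
    restrictTo_eq_zero_iff.2
      (ae_restrict_of_ae_restrict_of_subset (hA.subset_diff_closure (hΓ j) hd) (hg0 j))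
  -- On `Γ i` only the `i`-th trace of the sum survives, and on `Γ₀ i` none does.
  refine ⟨∑ i, v i, ∑ i, g i, HasTrace.sum _ hg, fun i => ?_, fun i => ?_⟩
  · rw [← restrictTo_eq_iff, map_sum, Finset.sum_eq_single i, restrictTo_eq_iff.2 (hgU i)]
    · exact fun j _ hj => hzero j (hΓ i) (hdisj i j hj.symm)
    · simp
  · rw [← restrictTo_eq_zero_iff, map_sum]
    exact Finset.sum_eq_zero fun j _ => hzero j (hΓ₀ i) (hdisj₀ j i).symm

end Data

end Electrostatics

end

/-! ### Existence, uniqueness and independence of the extension -/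

theorem theorem2p1 {n : ℕ} (hn : n = 2 ∨ n = 3)
    {Ω : Set (Electrostatics.E n)} (hΩ : Electrostatics.IsBoundedLipschitzDomain Ω)
    {k : ℕ} (Γ Γ₀ : Fin k → Set (Electrostatics.E n))
    (hΓ : ∀ i, Electrostatics.IsOpenInBoundary Ω (Γ i))
    (hΓ₀ : ∀ i, Electrostatics.IsOpenInBoundary Ω (Γ₀ i))
    (hne : (⋃ i, (Γ i ∪ Γ₀ i)).Nonempty)
    (hdisj : ∀ i j, i ≠ j → Disjoint (Γ i) (Γ j))
    (hdisj₀ : ∀ i j, Disjoint (Γ i) (Γ₀ j))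
    (ε : Electrostatics.E n → ℝ) (hε : MemLp ε ∞ (volume.restrict Ω))
    (e₁ e₂ : ℝ) (he₁ : 0 < e₁) (he₂ : 0 < e₂)
    (hbd : ∀ᵐ x ∂(volume.restrict Ω), e₁ ≤ ε x ∧ ε x ≤ e₂)
    (T : ℝ) (hT : 0 < T)
    (U : ∀ i, ℝ → Lp ℝ 2 ((Electrostatics.surfaceMeasure Ω).restrict (Γ i)))
    (hU : ∀ t ∈ Icc (0 : ℝ) T, ∀ i, U i t ∈ Electrostatics.H00half Ω (Γ i)) :
    ∀ t ∈ Icc (0 : ℝ) T,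
      (∃ θ' : Electrostatics.H1 Ω,
        Electrostatics.DirichletData Γ Γ₀ (fun i => U i t) θ') ∧
      ∃ θ : Electrostatics.H1 Ω,
        Electrostatics.IsGeneralizedSolution Γ Γ₀ ε (fun i => U i t) θ ∧
        (∀ η : Electrostatics.H1 Ω,
          Electrostatics.IsGeneralizedSolution Γ Γ₀ ε (fun i => U i t) η → η = θ) ∧
        ∀ θ' : Electrostatics.H1 Ω,
          Electrostatics.DirichletData Γ Γ₀ (fun i => U i t) θ' →
          ∃ u : Electrostatics.H1 Ω,
            Electrostatics.SolvesVariational Γ Γ₀ ε θ' u ∧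
            (∀ w : Electrostatics.H1 Ω,
              Electrostatics.SolvesVariational Γ Γ₀ ε θ' w → w = u) ∧
            θ = θ' + u := by
  intro t ht
  have := hΩ.isFiniteMeasure_surfaceMeasure
  have hpos := Electrostatics.surfaceMeasure_iUnion_pos hΩ hΓ hΓ₀ hne
  obtain ⟨θ₀, hθ₀⟩ := Electrostatics.exists_dirichletData hΓ hΓ₀ hdisj hdisj₀ (hU t ht)
  obtain ⟨u₀, hu₀, hu₀'⟩ := Electrostatics.exists_solvesVariational (Γ := Γ) (Γ₀ := Γ₀)
    hΩ hpos hε he₁ hbd θ₀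
  have hsol : Electrostatics.IsGeneralizedSolution Γ Γ₀ ε (fun i => U i t) (θ₀ + u₀) := by
    refine ⟨hθ₀.add_Vtilde hu₀, fun h hh => ?_⟩
    rw [Electrostatics.form_add_left hε he₁ hbd, hu₀' h hh, add_neg_cancel]
  refine ⟨⟨θ₀, hθ₀⟩, θ₀ + u₀, hsol, fun η hη => ?_, fun θ' hθ' => ?_⟩
  · refine Electrostatics.eq_of_form_eq hΩ hpos hε he₁ hbd (hη.1.sub_mem_Vtilde hsol.1) ?_
    exact fun w hw => (hη.2 w hw).trans (hsol.2 w hw).symm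
  -- For an arbitrary extension `θ'` the solution `u` is taken to be `θ - θ'`: it lies in `Ṽ`
  -- because both have the same Dirichlet data, and the identity `θ = θ' + u` is automatic.
  · have hu : Electrostatics.SolvesVariational Γ Γ₀ ε θ' (θ₀ + u₀ - θ') := by
      refine ⟨hsol.1.sub_mem_Vtilde hθ', fun h hh => ?_⟩
      rw [Electrostatics.form_sub_left hε he₁ hbd, hsol.2 h hh, zero_sub]
    refine ⟨_, hu, fun w hw => ?_, (add_sub_cancel _ _).symm⟩
    refine Electrostatics.eq_of_form_eq hΩ hpos hε he₁ hbd
      (Electrostatics.Vtilde_sub_mem hw.1 hu.1) ?_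
    exact fun h hh => (hw.2 h hh).trans (hu.2 h hh).symm
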